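/- An instance of SMTI-OLC consists of finite sets $W$ (workers), $F$ (firms) and $E=\{e_1,\dots,e_n\}$ (contracts); each contract $e$ belongs to one worker $w(e)$ and one firm $f(e)$ (parallel contracts are allowed). Each worker $w$ has a preference list, possibly with ties, on an arbitrary subset of $E_w=\{e: w(e)=w\}$; the contracts on these lists are called acceptable. Each firm $f$ has a preference list, possibly with ties, on all of $E_f=\{e: f(e)=f\}$, and a laminar family $\mathcal L_f$ of subsets of $E_f$ with quotas $q_f:\mathcal L_f\to\mathbb Z_{\ge 0}$. A set $S\subseteq E_f$ is feasible for $f$ if $|S\cap L|\le q_f(L)$ for all $L\in\mathcal L_f$. A matching is a set $M$ of acceptable contracts such that every worker has at most one contract in $M$ and $M_f=M\cap E_f$ is feasible for every firm $f$. A contract $e\in E\setminus M$ blocks $M$ if $e$ is acceptable, $w(e)$ has no contract in $M$ or strictly prefers $e$ to it, and, for $f=f(e)$, $M_f\cup\{e\}$ is feasible for $f$ or there is $e'\in M_f$ such that $f$ strictly prefers $e$ to $e'$ and $(M_f\cup\{e\})\setminus\{e'\}$ is feasible for $f$. A matching is stable if no contract blocks it. A worker $w$ weakly prefers $M$ to $M'$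 with respect to her list $P_w$ if she has no contract on $P_w$ in $M'$, or she has a contract on $P_w$ in both and does not strictly prefer the one in $M'$. A stable matching $M$ is worker-optimal if every worker weakly prefers $M$ to every other stable matching. A mechanism $A$ is worker-strategy-proof if, for every instance $I$, every worker $w$ and every instance $I'$ obtained from $I$ by replacing $P_w$ by another list on a subset of $E_w$, $w$ weakly prefers $A(I)$ to $A(I')$ with respect to $P_w$. Theorem. There is a mechanism $A$ such that, for every instance $I$ of SMTI-OLC, $A(I)$ is the worker-optimal stable matching of the instance obtained from $I$ by breaking all ties (of workers and firms) so that contracts with smaller indices have priority. This $A$ is worker-strategy-proof; $A(I)$ is a stable matching of $I$; and $|A(I)|\ge\frac12|M_{\mathrm{OPT}}|$ for every maximum-cardinality stable matching $M_{\mathrm{OPT}}$ of $I$. Moreover, a single program of a unit-cost random access machine (with addition and truncated subtraction) computes $A(I)$ from $I$ in $O(\max(k,1)\cdot\max(|E|,1)^2)$ steps, that is, $O(k\cdot|E|^2)$ steps whenever $k,|E|\ge 1$, where $k$ is the maximum length of a chain $L_1\subsetneq\dots\subsetneq L_k$ of members of one of the families $\mathcal L_f$ $(f\in F)$. -/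

import Mathlib

namespace OLC

/-! ### Preference lists -/

/-- A preference list with ties over (a subset of) the contracts `0, …, n - 1`: the ties are listed
from the most to the least preferred; a contract in no proper tie is a tie of size one. -/
structure PrefList (n : ℕ) where
  ties : List (Finset (Fin n))
  nonempty : ∀ t ∈ ties, t.Nonempty
  disjoint : ties.Pairwise Disjoint

namespace PrefList

variable {n : ℕ}

/-- The contract `e` appears in the list. -/
def Mem (P : PrefList n) (e : Fin n) : Prop := ∃ t ∈ P.ties, e ∈ t

/-- The position (from 0) of the tie containing `e`; used only for `e` appearing in the list. -/
def rank (P : PrefList n) (e : Fin n) : ℕ := P.ties.findIdx (fun t => decide (e ∈ t))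

/-- `e` is strictly preferred to `e'`. -/
def Prefers (P : PrefList n) (e e' : Fin n) : Prop :=
  P.Mem e ∧ P.Mem e' ∧ P.rank e < P.rank e'

/-- Break all ties, smaller indices first. -/
def breakTies (P : PrefList n) : PrefList n where
  ties := P.ties.flatMap fun t => (t.sort (· ≤ ·)).map fun e => {e}
  nonempty := by
    intro s hs
    simp only [List.mem_flatMap, List.mem_map] at hs
    obtain ⟨t, -, e, -, rfl⟩ := hs
    exact Finset.singleton_nonempty e
  disjoint := by
    rw [List.pairwise_flatMap]
    constructor
    · intro t _
      rw [List.pairwise_map]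
      refine (Finset.sort_nodup t (· ≤ ·)).imp ?_
      intro a b hab
      simpa using hab
    · refine P.disjoint.imp ?_
      intro s t hst x hx y hy
      simp only [List.mem_map, Finset.mem_sort] at hx hy
      obtain ⟨a, ha, rfl⟩ := hx
      obtain ⟨b, hb, rfl⟩ := hy
      simp only [Finset.disjoint_singleton]
      rintro rfl
      exact Finset.disjoint_left.mp hst ha hb

theorem mem_breakTies (P : PrefList n) (e : Fin n) : P.breakTies.Mem e ↔ P.Mem e := by
  simp [Mem, breakTies]

end PrefList

/-! ### Stable matching with ties and one-sided laminar constraints -/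

/-- An instance with workers `Fin nW`, firms `Fin nF` and contracts `Fin nE`. The contract `e` is an
edge between `worker e` and `firm e` (parallel contracts are allowed). A worker ranks some of her
contracts (the others are unacceptable to her), a firm ranks all of its contracts, and every firm
has a laminar family of sets of its contracts with a quota for each member. -/
structure Market (nW nF nE : ℕ) where
  worker : Fin nE → Fin nW
  firm : Fin nE → Fin nF
  wPref : Fin nW → PrefList nE
  wPref_sub : ∀ w e, (wPref w).Mem e → worker e = w
  fPref : Fin nF → PrefList nE
  fPref_iff : ∀ f e, (fPref f).Mem e ↔ firm e = f
  lam : Fin nF → Finset (Finset (Fin nE))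
  lam_sub : ∀ f, ∀ L ∈ lam f, ∀ e ∈ L, firm e = f
  laminar : ∀ f, ∀ L ∈ lam f, ∀ L' ∈ lam f, L ⊆ L' ∨ L' ⊆ L ∨ Disjoint L L'
  quota : ∀ f, {L // L ∈ lam f} → ℕ

namespace Market

variable {nW nF nE : ℕ}

/-- The contracts of worker `w` in `M`. -/
def ofWorker (I : Market nW nF nE) (M : Finset (Fin nE)) (w : Fin nW) : Finset (Fin nE) :=
  M.filter fun e => I.worker e = w

/-- The contracts of firm `f` in `M`. -/
def ofFirm (I : Market nW nF nE) (M : Finset (Fin nE)) (f : Fin nF) : Finset (Fin nE) :=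
  M.filter fun e => I.firm e = f

/-- The contract `e` is acceptable to its worker. -/
def Acceptable (I : Market nW nF nE) (e : Fin nE) : Prop := (I.wPref (I.worker e)).Mem e

/-- The set `S` satisfies all quotas of firm `f`. -/
def FirmFeasible (I : Market nW nF nE) (f : Fin nF) (S : Finset (Fin nE)) : Prop :=
  ∀ L : {L // L ∈ I.lam f}, (S ∩ L.1).card ≤ I.quota f L

structure IsMatching (I : Market nW nF nE) (M : Finset (Fin nE)) : Prop where
  acceptable : ∀ e ∈ M, I.Acceptable e
  worker_le : ∀ w, (I.ofWorker M w).card ≤ 1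
  firm_feasible : ∀ f, I.FirmFeasible f (I.ofFirm M f)

/-- `e` is free for its worker in `M`: it is acceptable, and the worker is unassigned or prefers `e`
to the contract assigned to her. -/
def FreeForWorker (I : Market nW nF nE) (M : Finset (Fin nE)) (e : Fin nE) : Prop :=
  I.Acceptable e ∧
    (I.ofWorker M (I.worker e) = ∅ ∨
      ∃ e' ∈ I.ofWorker M (I.worker e), (I.wPref (I.worker e)).Prefers e e')

/-- `e` is free for its firm in `M`: it can be added, possibly in exchange for a strictly less
preferred contract. -/
def FreeForFirm (I : Market nW nF nE) (M : Finset (Fin nE)) (e : Fin nE) : Prop :=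
  I.FirmFeasible (I.firm e) (insert e (I.ofFirm M (I.firm e))) ∨
    ∃ e' ∈ I.ofFirm M (I.firm e), (I.fPref (I.firm e)).Prefers e e' ∧
      I.FirmFeasible (I.firm e) ((insert e (I.ofFirm M (I.firm e))).erase e')

def Blocks (I : Market nW nF nE) (M : Finset (Fin nE)) (e : Fin nE) : Prop :=
  e ∉ M ∧ I.FreeForWorker M e ∧ I.FreeForFirm M e

def IsStable (I : Market nW nF nE) (M : Finset (Fin nE)) : Prop :=
  I.IsMatching M ∧ ∀ e, ¬ I.Blocks M e

/-- `M` is a maximum-cardinality stable matching. -/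
def IsMaxStable (I : Market nW nF nE) (M : Finset (Fin nE)) : Prop :=
  I.IsStable M ∧ ∀ N, I.IsStable N → N.card ≤ M.card

/-- Worker `w` weakly prefers `M` to `M'` with respect to her list in `I`: in `M'` she has no
contract on that list, or she has one in both and does not strictly prefer the one in `M'`. -/
def WeaklyPrefers (I : Market nW nF nE) (w : Fin nW) (M M' : Finset (Fin nE)) : Prop :=
  (¬ ∃ e' ∈ I.ofWorker M' w, (I.wPref w).Mem e') ∨
    ∃ e ∈ I.ofWorker M w, ∃ e' ∈ I.ofWorker M' w,
      (I.wPref w).Mem e ∧ (I.wPref w).Mem e' ∧ ¬ (I.wPref w).Prefers e' e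

/-- `M` is a worker-optimal stable matching. -/
def IsWorkerOptimal (I : Market nW nF nE) (M : Finset (Fin nE)) : Prop :=
  I.IsStable M ∧ ∀ N, I.IsStable N → ∀ w, I.WeaklyPrefers w M N

/-- Break the ties of all agents by index. -/
def breakTies (I : Market nW nF nE) : Market nW nF nE where
  worker := I.worker
  firm := I.firm
  wPref w := (I.wPref w).breakTies
  wPref_sub w e h := I.wPref_sub w e (((I.wPref w).mem_breakTies e).mp h)
  fPref f := (I.fPref f).breakTies
  fPref_iff f e := ((I.fPref f).mem_breakTies e).trans (I.fPref_iff f e)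
  lam := I.lam
  lam_sub := I.lam_sub
  laminar := I.laminar
  quota := I.quota

/-- Replace the preference list of worker `w` by `P`, any list over contracts of `w`. -/
def replaceList (I : Market nW nF nE) (w : Fin nW) (P : PrefList nE)
    (hP : ∀ e, P.Mem e → I.worker e = w) : Market nW nF nE where
  worker := I.worker
  firm := I.firm
  wPref := Function.update I.wPref w P
  wPref_sub := by
    intro v e h
    by_cases hv : v = w
    · subst hv
      rw [Function.update_self] at h
      exact hP e h
    · rw [Function.update_of_ne hv] at h
      exact I.wPref_sub v e h
  fPref := I.fPref
  fPref_iff := I.fPref_iff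
  lam := I.lam
  lam_sub := I.lam_sub
  laminar := I.laminar
  quota := I.quota

open Classical in
/-- The maximum level of nesting: the largest length of a chain in one of the laminar families. -/
noncomputable def level (I : Market nW nF nE) : ℕ :=
  Finset.univ.sup fun f =>
    ((I.lam f).powerset.filter fun C : Finset (Finset (Fin nE)) =>
      IsChain (· ⊆ ·) (C : Set (Finset (Fin nE)))).sup
      Finset.card

end Market

/-! ### Mechanisms -/

/-- A map from instances to sets of contracts. -/
def Mechanism : Type := ∀ nW nF nE : ℕ, Market nW nF nE → Finset (Fin nE)

def Mechanism.WorkerStrategyProof (A : Mechanism) : Prop :=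
  ∀ (nW nF nE : ℕ) (I : Market nW nF nE) (w : Fin nW) (P : PrefList nE)
    (hP : ∀ e, P.Mem e → I.worker e = w),
    I.WeaklyPrefers w (A nW nF nE I) (A nW nF nE (I.replaceList w P hP))

/-! ### Random access programs with unit cost

Programs act on finitely many variables and finitely many arrays (those that occur in the program)
holding natural numbers. The arithmetic is addition and truncated subtraction; there is no
multiplication. Every node of an expression, every assignment and every evaluation of a condition
costs one step. -/

structure State where
  var : ℕ → ℕ
  arr : ℕ → ℕ → ℕ

inductive Expr where
  | lit (c : ℕ)
  | var (x : ℕ)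
  | read (a : ℕ) (i : Expr)
  | add (s t : Expr)
  | sub (s t : Expr)

def Expr.eval (σ : State) : Expr → ℕ
  | lit c => c
  | var x => σ.var x
  | read a i => σ.arr a (i.eval σ)
  | add s t => s.eval σ + t.eval σ
  | sub s t => s.eval σ - t.eval σ

def Expr.cost : Expr → ℕ
  | lit _ => 1
  | var _ => 1
  | read _ i => i.cost + 1
  | add s t => s.cost + t.cost + 1
  | sub s t => s.cost + t.cost + 1

inductive Program where
  | skip
  | assign (x : ℕ) (v : Expr)
  | write (a : ℕ) (i v : Expr)
  | seq (p q : Program)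
  | ite (b : Expr) (p q : Program)
  | loop (b : Expr) (p : Program)

def State.setVar (σ : State) (x v : ℕ) : State :=
  ⟨Function.update σ.var x v, σ.arr⟩

def State.setArr (σ : State) (a i v : ℕ) : State :=
  ⟨σ.var, Function.update σ.arr a (Function.update (σ.arr a) i v)⟩

/-- `Run p σ σ' t`: the program `p`, started in `σ`, halts in `σ'` after `t` steps. A condition
counts as true if its value is not `0`; `loop b p` repeats `p` while `b` is true. -/
inductive Run : Program → State → State → ℕ → Prop where
  | skip (σ : State) : Run .skip σ σ 1
  | assign (σ : State) (x : ℕ) (v : Expr) :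
      Run (.assign x v) σ (σ.setVar x (v.eval σ)) (v.cost + 1)
  | write (σ : State) (a : ℕ) (i v : Expr) :
      Run (.write a i v) σ (σ.setArr a (i.eval σ) (v.eval σ)) (i.cost + v.cost + 1)
  | seq {p q : Program} {σ σ₁ σ₂ : State} {t₁ t₂ : ℕ} :
      Run p σ σ₁ t₁ → Run q σ₁ σ₂ t₂ → Run (.seq p q) σ σ₂ (t₁ + t₂)
  | ite_true {b : Expr} {p q : Program} {σ σ₁ : State} {t : ℕ} :
      b.eval σ ≠ 0 → Run p σ σ₁ t → Run (.ite b p q) σ σ₁ (b.cost + 1 + t)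
  | ite_false {b : Expr} {p q : Program} {σ σ₁ : State} {t : ℕ} :
      b.eval σ = 0 → Run q σ σ₁ t → Run (.ite b p q) σ σ₁ (b.cost + 1 + t)
  | loop_true {b : Expr} {p : Program} {σ σ₁ σ₂ : State} {t₁ t₂ : ℕ} :
      b.eval σ ≠ 0 → Run p σ σ₁ t₁ → Run (.loop b p) σ₁ σ₂ t₂ →
        Run (.loop b p) σ σ₂ (b.cost + 1 + t₁ + t₂)
  | loop_false {b : Expr} {p : Program} {σ : State} :
      b.eval σ = 0 → Run (.loop b p) σ σ (b.cost + 1)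

/-! ### Input and output -/

/-- The state `σ` holds the instance `I` as input. Variables 0, 1, 2 hold the numbers of contracts,
workers and firms; arrays 0 and 1 the worker and the firm of each contract. Array 2 holds the
position (from 1) of each contract in the list of its worker, with 0 for an unacceptable contract,
and array 3 its position (from 1) in the list of its firm; tied contracts have equal positions.
The nonempty members of the laminar families are listed once each, in any order, as `S 0, …,
S (m - 1)` (an empty member imposes no constraint): `m` is in variable 3, the quota of `S j` in
array 4, and array 6 holds the elements of `S 0`, then those of `S 1` and so on, each in any order,
those of `S j` starting at the place given in array 5. Nothing is assumed on the other variables and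
array cells. -/
structure IsInput {nW nF nE : ℕ} (I : Market nW nF nE) (σ : State) : Prop where
  contracts : σ.var 0 = nE
  workers : σ.var 1 = nW
  firms : σ.var 2 = nF
  worker : ∀ e : Fin nE, σ.arr 0 e = I.worker e
  firm : ∀ e : Fin nE, σ.arr 1 e = I.firm e
  worker_acc : ∀ e : Fin nE, I.Acceptable e → σ.arr 2 e = (I.wPref (I.worker e)).rank e + 1
  worker_unacc : ∀ e : Fin nE, ¬ I.Acceptable e → σ.arr 2 e = 0
  firm_pos : ∀ e : Fin nE, σ.arr 3 e = (I.fPref (I.firm e)).rank e + 1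
  families : ∃ S : Fin (σ.var 3) → Finset (Fin nE),
    Function.Injective S ∧
    (∀ L, (∃ j, S j = L) ↔ L.Nonempty ∧ ∃ f, L ∈ I.lam f) ∧
    (∀ j f (h : S j ∈ I.lam f), σ.arr 4 j = I.quota f ⟨S j, h⟩) ∧
    σ.arr 5 0 = 0 ∧
    (∀ j : Fin (σ.var 3), σ.arr 5 (j + 1) = σ.arr 5 j + (S j).card) ∧
    (∀ j e, e ∈ S j ↔ ∃ i < (S j).card, σ.arr 6 (σ.arr 5 j + i) = (e : ℕ))

/-- The state `σ` holds the set `M` of contracts as output: array 7 holds its indicator. -/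
def IsOutput {nE : ℕ} (M : Finset (Fin nE)) (σ : State) : Prop :=
  ∀ e : Fin nE, σ.arr 7 e = if e ∈ M then 1 else 0

end OLC

/-! ### Preference lists, tie-breaking and counting in laminar families -/

namespace OLC

namespace PrefList

variable {n : ℕ}

/-! Break all ties by index and run deferred acceptance from the workers' side. An unassigned worker
proposes her best contract not yet rejected; if this violates a quota, a smallest overfull set loses
its worst contract. Two invariants in `DAInv` carry the argument: no stable matching contains a
rejected contract, and every acceptable rejected contract lies in a set whose quota is used up by
contracts that the firm prefers. The second yields stability at the end and the first
worker-optimality (`DAInv.isWorkerOptimal`); `Overfull.notMem_stable` and `DAInv.reject` preserve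
them through a rejection.

The combinatorial tool is `card_le_of_laminar`: inequalities on the members of a laminar family add
up over the maximal members. It shows that the contract being rejected is in no stable matching,
that a worker assigned by the worker-optimal matching is assigned by every stable one, and that a
stable matching has at least half the size of any matching (`card_le_two_mul`).

For strategy-proofness, let a false report yield the contract `e`. The outcome stays stable when the
worker reports `e` alone, so every stable matching for that report assigns her. Hence the optimal
matching for her true list cut off after `e` assigns her too, with something at least as good as
`e`; it is also stable for the full true list, so the truthful outcome is no worse.

Breaking ties keeps strict preferences, so stability passes back to the original market. The program
spends time linear in the input sets on each of `nE` rounds. The sets containing a given contract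
form a chain, so the set sizes sum to at most `nE * I.level`. Uniqueness of the worker-optimal
matching identifies the output with `A`. -/

theorem prefers_irrefl (P : PrefList n) (e : Fin n) : ¬ P.Prefers e e :=
  fun h => lt_irrefl _ h.2.2

theorem Prefers.trans {P : PrefList n} {a b c : Fin n} (h : P.Prefers a b) (h' : P.Prefers b c) :
    P.Prefers a c :=
  ⟨h.1, h'.2.1, h.2.2.trans h'.2.2⟩

theorem Prefers.asymm {P : PrefList n} {a b : Fin n} (h : P.Prefers a b) : ¬ P.Prefers b a :=
  fun h' => lt_asymm h.2.2 h'.2.2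

/-- A list without proper ties. -/
def Strict (P : PrefList n) : Prop :=
  ∀ e e', P.Mem e → P.Mem e' → e ≠ e' → P.Prefers e e' ∨ P.Prefers e' e

theorem mem_iff_rank_lt (P : PrefList n) (e : Fin n) : P.Mem e ↔ P.rank e < P.ties.length := by
  simp [Mem, rank, List.findIdx_lt_length]

theorem findIdx_sort_lt {s : Finset (Fin n)} {e e' : Fin n} (he : e ∈ s) (he' : e' ∈ s)
    (h : e < e') :
    (((s.sort (· ≤ ·)).map fun x => ({x} : Finset (Fin n))).findIdx fun t => decide (e ∈ t)) <
      (((s.sort (· ≤ ·)).map fun x => ({x} : Finset (Fin n))).findIdx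
        fun t => decide (e' ∈ t)) := by
  have key : ∀ l : List (Fin n), l.Pairwise (· ≤ ·) → e ∈ l → e' ∈ l →
      ((l.map fun x => ({x} : Finset (Fin n))).findIdx fun t => decide (e ∈ t)) <
      ((l.map fun x => ({x} : Finset (Fin n))).findIdx fun t => decide (e' ∈ t)) := by
    intro l
    induction l with
    | nil => simp
    | cons a l ih =>
      intro hl h1 h2
      rw [List.pairwise_cons] at hl
      simp only [List.map_cons, List.findIdx_cons, Finset.mem_singleton]
      by_cases ha : e = a
      · have : e' ≠ a := by rintro rfl; exact absurd ha h.ne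
        simp [ha, this]
      · have h1' : e ∈ l := by simpa [ha] using h1
        have : e' ≠ a := by
          rintro rfl
          exact absurd (hl.1 e h1') (not_le.mpr h)
        have h2' : e' ∈ l := by simpa [this] using h2
        simpa [ha, this] using ih hl.2 h1' h2'
  exact key _ (Finset.pairwise_sort s (· ≤ ·)) (by simpa using he) (by simpa using he')

theorem rank_breakTies_lt {P : PrefList n} {e e' : Fin n} (he : P.Mem e) (he' : P.Mem e')
    (h : P.rank e < P.rank e' ∨ P.rank e = P.rank e' ∧ e < e') :
    P.breakTies.rank e < P.breakTies.rank e' := by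
  unfold Mem at he he'
  unfold rank at *
  simp only [breakTies]
  revert he he' h
  generalize P.ties = l
  intro he he' h
  induction l with
  | nil => simp at he
  | cons t l ih =>
    -- Membership in the head tie decides which branch `findIdx_append` takes.
    have hmap : ∀ x : Fin n,
        (((t.sort (· ≤ ·)).map fun x => ({x} : Finset (Fin n))).findIdx
          fun s => decide (x ∈ s)) < ((t.sort (· ≤ ·)).map fun x => ({x} : Finset (Fin n))).length
        ↔ x ∈ t := by
      intro x
      rw [List.findIdx_lt_length]
      simp
    simp only [List.flatMap_cons, List.findIdx_append, hmap]
    simp only [List.findIdx_cons] at h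
    by_cases h1 : e ∈ t <;> by_cases h2 : e' ∈ t
    · simp only [h1, h2, if_true]
      exact findIdx_sort_lt h1 h2 (by simpa [h1, h2] using h)
    · simp only [h1, h2, if_true, if_false]
      exact ((hmap e).mpr h1).trans_le (Nat.le_add_left _ _)
    · simp [h1, h2] at h
    · simp only [h1, h2, if_false]
      have := ih (by simpa [h1] using he) (by simpa [h2] using he') (by simpa [h1, h2] using h)
      omega

theorem prefers_breakTies_iff {P : PrefList n} {e e' : Fin n} :
    P.breakTies.Prefers e e' ↔ P.Mem e ∧ P.Mem e' ∧
      (P.rank e < P.rank e' ∨ P.rank e = P.rank e' ∧ e < e') := by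
  simp only [Prefers, mem_breakTies]
  refine and_congr_right fun he => and_congr_right fun he' => ⟨fun h => ?_, rank_breakTies_lt he he'⟩
  by_contra hc
  rcases eq_or_ne e e' with rfl | hne
  · exact lt_irrefl _ h
  · refine lt_asymm h (rank_breakTies_lt he' he ?_)
    rcases lt_trichotomy e e' with h' | h' | h' <;> omega

theorem Prefers.breakTies {P : PrefList n} {e e' : Fin n} (h : P.Prefers e e') :
    P.breakTies.Prefers e e' :=
  prefers_breakTies_iff.mpr ⟨h.1, h.2.1, Or.inl h.2.2⟩

theorem strict_breakTies (P : PrefList n) : P.breakTies.Strict := by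
  intro e e' he he' hne
  rw [mem_breakTies] at he he'
  simp only [prefers_breakTies_iff, he, he', true_and]
  rcases lt_trichotomy e e' with h' | h' | h' <;> omega

/-- The list with the single entry `e`. -/
def single (e : Fin n) : PrefList n where
  ties := [{e}]
  nonempty := by simp
  disjoint := by simp

theorem mem_single {e x : Fin n} : (single e).Mem x ↔ x = e := by simp [Mem, single]

theorem strict_single (e : Fin n) : (single e).Strict := by
  intro x y hx hy hne
  rw [mem_single] at hx hy
  exact absurd (hx.trans hy.symm) hne

/-- The first `k` ties of a list. -/
def truncate (P : PrefList n) (k : ℕ) : PrefList n where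
  ties := P.ties.take k
  nonempty t ht := P.nonempty t (List.mem_of_mem_take ht)
  disjoint := P.disjoint.sublist (List.take_sublist k _)

theorem rank_truncate (P : PrefList n) (k : ℕ) (e : Fin n) :
    (P.truncate k).rank e = min k (P.rank e) := by
  simp [truncate, rank, List.findIdx_take]

theorem mem_truncate {P : PrefList n} {k : ℕ} {e : Fin n} :
    (P.truncate k).Mem e ↔ P.Mem e ∧ P.rank e < k := by
  rw [mem_iff_rank_lt, mem_iff_rank_lt, rank_truncate]
  simp only [truncate, List.length_take]
  omega

theorem prefers_truncate {P : PrefList n} {k : ℕ} {e e' : Fin n} :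
    (P.truncate k).Prefers e e' ↔ P.Prefers e e' ∧ P.rank e' < k := by
  simp only [Prefers, mem_truncate, rank_truncate]
  constructor
  · rintro ⟨⟨h1, h2⟩, ⟨h3, h4⟩, h5⟩
    exact ⟨⟨h1, h3, by omega⟩, h4⟩
  · rintro ⟨⟨h1, h2, h3⟩, h4⟩
    exact ⟨⟨h1, by omega⟩, ⟨h2, h4⟩, by omega⟩

theorem Strict.truncate {P : PrefList n} (hP : P.Strict) (k : ℕ) : (P.truncate k).Strict := by
  intro e e' he he' hne
  simp only [prefers_truncate]
  rw [mem_truncate] at he he'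
  exact (hP e e' he.1 he'.1 hne).imp (⟨·, he'.2⟩) (⟨·, he.2⟩)

end PrefList

/-- The maximal members of `K` are disjoint and cover the union of `K`, so their inequalities add
up; outside this union `T` is contained in `N`. -/
theorem card_le_of_laminar {α : Type*} [DecidableEq α] (K : Finset (Finset α))
    (hK : ∀ L ∈ K, ∀ L' ∈ K, L ⊆ L' ∨ L' ⊆ L ∨ Disjoint L L') (T N : Finset α)
    (hle : ∀ L ∈ K, (T ∩ L).card ≤ (N ∩ L).card) (hcov : ∀ x ∈ T, x ∉ N → ∃ L ∈ K, x ∈ L) :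
    T.card ≤ N.card := by
  have key : ∀ (m : ℕ) (K' : Finset (Finset α)), K'.card ≤ m → K' ⊆ K →
      (T ∩ K'.sup id).card ≤ (N ∩ K'.sup id).card := by
    intro m
    induction m with
    | zero =>
      intro K' h0 _
      rw [Finset.card_eq_zero.mp (Nat.le_zero.mp h0)]
      simp
    | succ m ih =>
      intro K' hm hK'
      rcases K'.eq_empty_or_nonempty with rfl | hne
      · simp
      -- A member of largest size is maximal under inclusion, so every member not inside it is
      -- disjoint from it. Members inside it add nothing to the union and are dropped.
      obtain ⟨L, hL, hmax⟩ := Finset.exists_max_image K' Finset.card hne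
      set K₁ := K'.filter fun L' => ¬ L' ⊆ L with hK₁
      have hlt : K₁.card < K'.card :=
        Finset.card_lt_card (Finset.filter_ssubset.mpr ⟨L, hL, by simp⟩)
      have h1 := ih K₁ (by omega) ((Finset.filter_subset _ _).trans hK')
      have hdisj : Disjoint L (K₁.sup id) := by
        rw [Finset.disjoint_sup_right]
        intro L' hL'
        rw [hK₁, Finset.mem_filter] at hL'
        rcases hK L (hK' hL) L' (hK' hL'.1) with h | h | h
        · exact absurd (Finset.eq_of_subset_of_card_le h (hmax L' hL'.1)).ge hL'.2
        · exact absurd h hL'.2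
        · exact h
      have hsup : K'.sup id = L ∪ K₁.sup id := by
        apply le_antisymm
        · refine Finset.sup_le fun L' hL' => ?_
          by_cases h : L' ⊆ L
          · exact h.trans Finset.subset_union_left
          · exact (Finset.le_sup (f := id) (Finset.mem_filter.mpr ⟨hL', h⟩)).trans
              Finset.subset_union_right
        · exact Finset.union_subset (Finset.le_sup (f := id) hL)
            (Finset.sup_mono (Finset.filter_subset _ _))
      have hsplit : ∀ X : Finset α,
          (X ∩ K'.sup id).card = (X ∩ L).card + (X ∩ K₁.sup id).card := by
        intro X
        rw [hsup, Finset.inter_union_distrib_left, Finset.card_union_of_disjoint]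
        exact hdisj.mono Finset.inter_subset_right Finset.inter_subset_right
      rw [hsplit, hsplit]
      exact Nat.add_le_add (hle L (hK' hL)) h1
  have h := key K.card K le_rfl subset_rfl
  have hT : T \ K.sup id ⊆ N \ K.sup id := by
    intro x hx
    rw [Finset.mem_sdiff] at hx ⊢
    refine ⟨?_, hx.2⟩
    by_contra hN
    obtain ⟨L, hL, hxL⟩ := hcov x hx.1 hN
    exact hx.2 (Finset.le_sup (f := id) hL hxL)
  have h2 := Finset.card_le_card hT
  have h3 := Finset.card_inter_add_card_sdiff T (K.sup id)
  have h4 := Finset.card_inter_add_card_sdiff N (K.sup id)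
  omega

end OLC

/-! ### Feasibility, blocking and the size of stable matchings -/

namespace OLC

namespace Market

variable {nW nF nE : ℕ}

/-- All quotas of all firms are satisfied. -/
def Feasible (I : Market nW nF nE) (S : Finset (Fin nE)) : Prop :=
  ∀ f, ∀ L : {L // L ∈ I.lam f}, (S ∩ L.1).card ≤ I.quota f L

/-- No two contracts are tied. -/
structure Strict (I : Market nW nF nE) : Prop where
  worker : ∀ w, (I.wPref w).Strict
  firm : ∀ f, (I.fPref f).Strict

theorem strict_breakTies (I : Market nW nF nE) : I.breakTies.Strict :=
  ⟨fun w => (I.wPref w).strict_breakTies, fun f => (I.fPref f).strict_breakTies⟩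

section Basic

variable {I : Market nW nF nE} {M N : Finset (Fin nE)} {e e' : Fin nE} {w : Fin nW} {f : Fin nF}

theorem mem_ofWorker : e ∈ I.ofWorker M w ↔ e ∈ M ∧ I.worker e = w := by simp [ofWorker]

theorem mem_ofFirm : e ∈ I.ofFirm M f ↔ e ∈ M ∧ I.firm e = f := by simp [ofFirm]

theorem ofFirm_inter {L : Finset (Fin nE)} (hL : L ∈ I.lam f) : I.ofFirm M f ∩ L = M ∩ L := by
  ext x
  simp only [Finset.mem_inter, mem_ofFirm]
  exact ⟨fun h => ⟨h.1.1, h.2⟩, fun h => ⟨⟨h.1, I.lam_sub f L hL x h.2⟩, h.2⟩⟩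

theorem firmFeasible_ofFirm :
    I.FirmFeasible f (I.ofFirm M f) ↔ ∀ L : {L // L ∈ I.lam f}, (M ∩ L.1).card ≤ I.quota f L := by
  simp only [FirmFeasible]
  exact forall_congr' fun L => by rw [ofFirm_inter L.2]

theorem insert_ofFirm : insert e (I.ofFirm M (I.firm e)) = I.ofFirm (insert e M) (I.firm e) := by
  ext x
  simp only [Finset.mem_insert, mem_ofFirm]
  constructor
  · rintro (rfl | h)
    · exact ⟨Or.inl rfl, rfl⟩
    · exact ⟨Or.inr h.1, h.2⟩
  · rintro ⟨h | h, h'⟩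
    · exact Or.inl h
    · exact Or.inr ⟨h, h'⟩

theorem erase_ofFirm : (I.ofFirm M f).erase e = I.ofFirm (M.erase e) f := by
  ext x
  simp only [Finset.mem_erase, mem_ofFirm, and_assoc]

theorem isMatching_iff : I.IsMatching M ↔
    (∀ e ∈ M, I.Acceptable e) ∧ (∀ w, (I.ofWorker M w).card ≤ 1) ∧ I.Feasible M :=
  ⟨fun h => ⟨h.1, h.2, fun f => firmFeasible_ofFirm.mp (h.3 f)⟩,
    fun h => ⟨h.1, h.2.1, fun f => firmFeasible_ofFirm.mpr (h.2.2 f)⟩⟩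

theorem IsMatching.feasible (h : I.IsMatching M) : I.Feasible M := (isMatching_iff.mp h).2.2

theorem IsMatching.eq_of_worker_eq (h : I.IsMatching M) (he : e ∈ M) (he' : e' ∈ M)
    (hw : I.worker e = I.worker e') : e = e' :=
  Finset.card_le_one.mp (h.worker_le (I.worker e')) e (mem_ofWorker.mpr ⟨he, hw⟩) e'
    (mem_ofWorker.mpr ⟨he', rfl⟩)

theorem acceptable_of_mem (h : (I.wPref w).Mem e) : I.Acceptable e := by
  have := I.wPref_sub w e h
  subst this
  exact h

/-- The restriction to one firm can be dropped: its sets contain only its own contracts, and a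
contract that it ranks is its own. -/
theorem freeForFirm_iff : I.FreeForFirm M e ↔
    (∀ L : {L // L ∈ I.lam (I.firm e)}, (insert e M ∩ L.1).card ≤ I.quota _ L) ∨
    ∃ e' ∈ M, (I.fPref (I.firm e)).Prefers e e' ∧
      ∀ L : {L // L ∈ I.lam (I.firm e)},
        ((insert e M).erase e' ∩ L.1).card ≤ I.quota _ L := by
  simp only [FreeForFirm, insert_ofFirm, erase_ofFirm, firmFeasible_ofFirm, mem_ofFirm]
  refine or_congr_right (exists_congr fun x => ?_)
  constructor
  · rintro ⟨⟨h1, _⟩, h3, h4⟩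
    exact ⟨h1, h3, h4⟩
  · rintro ⟨h1, h3, h4⟩
    exact ⟨⟨h1, (I.fPref_iff _ _).mp h3.2.1⟩, h3, h4⟩

theorem card_insert_inter_le (S L : Finset (Fin nE)) (e : Fin nE) :
    (insert e S ∩ L).card ≤ (S ∩ L).card + 1 := by
  by_cases he : e ∈ L
  · rw [Finset.insert_inter_of_mem he]
    exact Finset.card_insert_le _ _
  · rw [Finset.insert_inter_of_notMem he]
    exact Nat.le_succ _

/-- A contract that cannot be added lies in a set with no free capacity. -/
theorem exists_tight (hM : I.Feasible M)
    (h : ¬ ∀ L : {L // L ∈ I.lam f}, (insert e M ∩ L.1).card ≤ I.quota f L) :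
    ∃ L : {L // L ∈ I.lam f}, e ∈ L.1 ∧ I.quota f L ≤ (M ∩ L.1).card := by
  push Not at h
  obtain ⟨L, hL⟩ := h
  refine ⟨L, ?_, by have := card_insert_inter_le M L.1 e; omega⟩
  by_contra he
  rw [Finset.insert_inter_of_notMem he] at hL
  exact absurd (hM f L) (not_le.mpr hL)

theorem exists_tight_of_not_freeForFirm (hM : I.Feasible M) (h : ¬ I.FreeForFirm M e) :
    ∃ L : {L // L ∈ I.lam (I.firm e)}, e ∈ L.1 ∧ I.quota _ L ≤ (M ∩ L.1).card :=
  exists_tight hM fun h' => h (freeForFirm_iff.mpr (Or.inl h'))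

/-- The contract `e` lies in a set whose quota is exhausted by contracts preferred to `e`. -/
def Dominated (I : Market nW nF nE) (M : Finset (Fin nE)) (e : Fin nE) : Prop :=
  ∃ L : {L // L ∈ I.lam (I.firm e)}, e ∈ L.1 ∧ I.quota _ L ≤ (M ∩ L.1).card ∧
    ∀ x ∈ M ∩ L.1, (I.fPref (I.firm e)).Prefers x e

/-- Adding `e` overfills the witness set, and a contract worse than `e` given up in exchange lies
outside that set, so the overflow remains. -/
theorem Dominated.not_freeForFirm (h : I.Dominated M e) : ¬ I.FreeForFirm M e := by
  obtain ⟨L, heL, hq, hp⟩ := h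
  have heM : e ∉ M := fun he => PrefList.prefers_irrefl _ _ (hp e (Finset.mem_inter.mpr ⟨he, heL⟩))
  have hc : (insert e M ∩ L.1).card = (M ∩ L.1).card + 1 := by
    rw [Finset.insert_inter_of_mem heL, Finset.card_insert_of_notMem]
    exact fun h => heM (Finset.mem_inter.mp h).1
  rw [freeForFirm_iff]
  rintro (h | ⟨x, hx, hex, h⟩)
  · have := h L
    omega
  · have := h L
    rw [Finset.erase_inter, Finset.erase_eq_of_notMem] at this
    · omega
    · intro hxL
      have hxL' := (Finset.mem_inter.mp hxL).2
      exact (hp x (Finset.mem_inter.mpr ⟨hx, hxL'⟩)).asymm hex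

/-- Sets of different firms are disjoint, so the families of all firms together are laminar and
counting can be done globally. -/
theorem laminar_of_mem {f f' : Fin nF} {L L' : Finset (Fin nE)} (hL : L ∈ I.lam f)
    (hL' : L' ∈ I.lam f') : L ⊆ L' ∨ L' ⊆ L ∨ Disjoint L L' := by
  by_cases h : f = f'
  · subst h
    exact I.laminar f L hL L' hL'
  · refine Or.inr (Or.inr (Finset.disjoint_left.mpr fun x hx hx' => h ?_))
    rw [← I.lam_sub f L hL x hx, I.lam_sub f' L' hL' x hx']

open Classical in
theorem card_le_of_tight {T N : Finset (Fin nE)}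
    (h : ∀ x ∈ T, x ∉ N → ∃ f, ∃ L ∈ I.lam f, x ∈ L ∧ (T ∩ L).card ≤ (N ∩ L).card) :
    T.card ≤ N.card := by
  refine card_le_of_laminar
    ((Finset.univ.biUnion I.lam).filter fun L => (T ∩ L).card ≤ (N ∩ L).card) ?_ T N ?_ ?_
  · intro L hL L' hL'
    simp only [Finset.mem_filter, Finset.mem_biUnion, Finset.mem_univ, true_and] at hL hL'
    obtain ⟨⟨f, hf⟩, -⟩ := hL
    obtain ⟨⟨f', hf'⟩, -⟩ := hL'
    exact laminar_of_mem hf hf'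
  · intro L hL
    exact (Finset.mem_filter.mp hL).2
  · intro x hx hxN
    obtain ⟨f, L, hL, hxL, hle⟩ := h x hx hxN
    exact ⟨L, by simpa using ⟨⟨f, hL⟩, hle⟩, hxL⟩

end Basic

section Size

variable {I : Market nW nF nE} {M N : Finset (Fin nE)} {e e' : Fin nE} {w : Fin nW} {f : Fin nF}

/-- Contracts of `N` whose workers are assigned in `M` number at most `M.card`, one per worker. Any
other contract of `N` is wanted by its worker, so the firm refuses it because of a set filled by
`M`; laminar counting bounds these by `M.card` as well. -/
theorem card_le_two_mul (hM : I.IsStable M) (hN : I.IsMatching N) : N.card ≤ 2 * M.card := by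
  classical
  have h1 : (N.filter fun e => I.worker e ∈ M.image I.worker).card ≤ M.card := by
    refine (Finset.card_le_card_of_injOn I.worker (t := M.image I.worker) ?_ ?_).trans
      Finset.card_image_le
    · intro e he
      exact (Finset.mem_filter.mp he).2
    · intro e he e' he' hw
      exact hN.eq_of_worker_eq (Finset.mem_filter.mp he).1 (Finset.mem_filter.mp he').1 hw
  have h2 : (N.filter fun e => ¬ I.worker e ∈ M.image I.worker).card ≤ M.card := by
    refine card_le_of_tight (I := I) fun x hx hxM => ?_
    rw [Finset.mem_filter] at hx
    have hfree : ¬ I.FreeForFirm M x := fun hf => hM.2 x ⟨hxM, ⟨hN.acceptable x hx.1, Or.inl ?_⟩, hf⟩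
    · obtain ⟨L, hxL, hq⟩ := exists_tight_of_not_freeForFirm hM.1.feasible hfree
      refine ⟨_, L.1, L.2, hxL, ?_⟩
      exact (Finset.card_le_card (Finset.inter_subset_inter_right (Finset.filter_subset _ _))).trans
        ((hN.feasible _ L).trans hq)
    · rw [Finset.eq_empty_iff_forall_notMem]
      intro y hy
      rw [mem_ofWorker] at hy
      exact hx.2 (Finset.mem_image.mpr ⟨y, hy⟩)
  have := Finset.card_filter_add_card_filter_not (s := N) fun e => I.worker e ∈ M.image I.worker
  omega

theorem IsMatching.card_image_worker (hM : I.IsMatching M) :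
    (M.image I.worker).card = M.card :=
  Finset.card_image_of_injOn fun _ he _ he' hw => hM.eq_of_worker_eq he he' hw

theorem IsMatching.exists_of_weaklyPrefers (hN : I.IsMatching N) (h : I.WeaklyPrefers w M N)
    (he : e ∈ I.ofWorker N w) : ∃ x ∈ I.ofWorker M w, (I.wPref w).Mem x ∧
      ¬ (I.wPref w).Prefers e x := by
  have he' := mem_ofWorker.mp he
  have hacc := hN.acceptable e he'.1
  rw [Acceptable, he'.2] at hacc
  rcases h with h | ⟨x, hx, y, hy, hx', -, hxy⟩
  · exact absurd ⟨e, he, hacc⟩ h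
  · rw [mem_ofWorker] at hy
    rw [hN.eq_of_worker_eq he'.1 hy.1 (he'.2.trans hy.2.symm)]
    exact ⟨x, hx, hx', hxy⟩

/-- A worker assigned by the worker-optimal stable matching is assigned by all of them. -/
theorem exists_mem_of_isWorkerOptimal (hI : I.Strict) (hM : I.IsWorkerOptimal M)
    (hN : I.IsStable N) (he : e ∈ M) : ∃ x ∈ N, I.worker x = I.worker e := by
  -- By optimality and strictness, a worker prefers her contract in `M` to a different assignment in
  -- `N`. As it does not block `N`, it lies in a set filled by `N`.
  have hcard : M.card ≤ N.card := by
    refine card_le_of_tight (I := I) fun x hx hxN => ?_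
    have hacc := hM.1.1.acceptable x hx
    have hfree : ¬ I.FreeForFirm N x := fun hf => hN.2 x ⟨hxN, ⟨hacc, ?_⟩, hf⟩
    · obtain ⟨L, hxL, hq⟩ := exists_tight_of_not_freeForFirm hN.1.feasible hfree
      exact ⟨_, L.1, L.2, hxL, (hM.1.1.feasible _ L).trans hq⟩
    · rcases (I.ofWorker N (I.worker x)).eq_empty_or_nonempty with h | ⟨y, hy⟩
      · exact Or.inl h
      · refine Or.inr ⟨y, hy, ?_⟩
        obtain ⟨z, hz, hz', hyz⟩ := hN.1.exists_of_weaklyPrefers (hM.2 N hN _) hy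
        rw [mem_ofWorker] at hz hy
        rw [hM.1.1.eq_of_worker_eq hz.1 hx hz.2] at hyz hz'
        have hy' := hN.1.acceptable y hy.1
        rw [Acceptable, hy.2] at hy'
        exact (hI.worker _ x y hz' hy' fun h => hxN (h ▸ hy.1)).resolve_right hyz
  -- Optimality makes the assigned workers of `N` a subset of those of `M`; the cardinalities force
  -- equality.
  have hsub : N.image I.worker ⊆ M.image I.worker := by
    intro w hw
    obtain ⟨y, hy, rfl⟩ := Finset.mem_image.mp hw
    obtain ⟨z, hz, -, -⟩ := hN.1.exists_of_weaklyPrefers (hM.2 N hN _) (mem_ofWorker.mpr ⟨hy, rfl⟩)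
    rw [mem_ofWorker] at hz
    exact Finset.mem_image.mpr ⟨z, hz⟩
  have heq := Finset.eq_of_subset_of_card_le hsub
    (by rw [hM.1.1.card_image_worker, hN.1.card_image_worker]; exact hcard)
  have := Finset.mem_image_of_mem I.worker he
  rw [← heq] at this
  simpa using this

/-- Each worker weakly prefers either matching to the other, which without ties means the same
contract. This is what ties the output of a program to an abstractly chosen matching. -/
theorem IsWorkerOptimal.unique (hI : I.Strict) (hM : I.IsWorkerOptimal M)
    (hN : I.IsWorkerOptimal N) : M = N := by
  have key : ∀ {M N : Finset (Fin nE)}, I.IsWorkerOptimal M → I.IsWorkerOptimal N → N ⊆ M := by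
    intro M N hM hN e he
    obtain ⟨x, hx, hx', hxe⟩ :=
      hN.1.1.exists_of_weaklyPrefers (hM.2 N hN.1 _) (mem_ofWorker.mpr ⟨he, rfl⟩)
    obtain ⟨y, hy, hy', hyx⟩ := hM.1.1.exists_of_weaklyPrefers (hN.2 M hM.1 _) hx
    rw [mem_ofWorker] at hx hy
    rw [hN.1.1.eq_of_worker_eq hy.1 he hy.2] at hyx hy'
    by_contra hne
    rcases hI.worker _ x e hx' hy' (fun h => hne (h ▸ hx.1)) with h | h
    · exact hyx h
    · exact hxe h
  exact (key hN hM).antisymm (key hM hN)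

end Size

end Market

end OLC

/-! ### Deferred acceptance and existence of the worker-optimal matching -/

namespace OLC

namespace Market

variable {nW nF nE : ℕ}

/-- The invariant of deferred acceptance with tentative matching `M` and rejected contracts `R`. -/
structure DAInv (I : Market nW nF nE) (M R : Finset (Fin nE)) : Prop where
  matching : I.IsMatching M
  disjoint : ∀ e ∈ M, e ∉ R
  unacceptable : ∀ e, ¬ I.Acceptable e → e ∈ R
  better : ∀ e ∈ M, ∀ x, (I.wPref (I.worker e)).Prefers x e → x ∈ R
  not_stable : ∀ e ∈ R, ∀ N, I.IsStable N → e ∉ N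
  dominated : ∀ e ∈ R, I.Acceptable e → I.Dominated M e

/-- The contract `e` can be proposed next. -/
structure Candidate (I : Market nW nF nE) (M R : Finset (Fin nE)) (e : Fin nE) : Prop where
  notMem : e ∉ R
  free : ∀ x ∈ M, I.worker x ≠ I.worker e

section Step

variable {I : Market nW nF nE} {M R : Finset (Fin nE)} {e e' : Fin nE} {f : Fin nF}

theorem Candidate.notMem_left (h : I.Candidate M R e) : e ∉ M := fun h' => h.free e h' rfl

open Classical in
theorem daInv_empty (I : Market nW nF nE) :
    I.DAInv ∅ (Finset.univ.filter fun e => ¬ I.Acceptable e) where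
  matching := isMatching_iff.mpr ⟨by simp, by simp [ofWorker], fun f L => by simp⟩
  disjoint := by simp
  unacceptable := by simp
  better := by simp
  not_stable e he N hN heN := (Finset.mem_filter.mp he).2 (hN.1.acceptable e heN)
  dominated e he h := absurd h (Finset.mem_filter.mp he).2

/-- When no contract can be proposed, the tentative matching is the worker-optimal one. -/
theorem DAInv.isWorkerOptimal (h : I.DAInv M R)
    (hdone : ∀ e, ¬ I.Candidate M R e) : I.IsWorkerOptimal M := by
  -- Without candidates, a contract that is not rejected belongs to an assigned worker, and `better`
  -- compares it with her assignment.
  have hcase : ∀ e, e ∉ R → ∃ x ∈ M, I.worker x = I.worker e := by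
    intro e he
    by_contra hc
    push Not at hc
    exact hdone e ⟨he, hc⟩
  refine ⟨⟨h.matching, ?_⟩, ?_⟩
  · rintro e ⟨heM, ⟨hacc, hfree⟩, hfirm⟩
    refine (h.dominated e ?_ hacc).not_freeForFirm hfirm
    by_contra heR
    obtain ⟨x, hx, hxe⟩ := hcase e heR
    rcases hfree with h' | ⟨y, hy, hey⟩
    · exact (Finset.eq_empty_iff_forall_notMem.mp h') x (mem_ofWorker.mpr ⟨hx, hxe⟩)
    · rw [mem_ofWorker] at hy
      rw [← hy.2] at hey
      exact heR (h.better y hy.1 e hey)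
  · intro N hN w
    by_cases hw : ∃ y ∈ I.ofWorker N w, (I.wPref w).Mem y
    · obtain ⟨y, hy, hyw⟩ := hw
      rw [mem_ofWorker] at hy
      have hyR : y ∉ R := fun hyR => h.not_stable y hyR N hN hy.1
      obtain ⟨x, hx, hxy⟩ := hcase y hyR
      have hxw := hxy.trans hy.2
      refine Or.inr ⟨x, mem_ofWorker.mpr ⟨hx, hxw⟩, y, mem_ofWorker.mpr hy, ?_, hyw, ?_⟩
      · have := h.matching.acceptable x hx
        rwa [Acceptable, hxw] at this
      · intro hp
        rw [← hxw] at hp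
        exact hyR (h.better x hx y hp)
    · exact Or.inl hw

theorem Candidate.worker_le (h : I.Candidate M R e) (hM : I.IsMatching M) (w : Fin nW) :
    (I.ofWorker (insert e M) w).card ≤ 1 := by
  rw [Finset.card_le_one]
  intro a ha b hb
  rw [mem_ofWorker, Finset.mem_insert] at ha hb
  obtain ⟨rfl | ha, haw⟩ := ha <;> obtain ⟨rfl | hb, hbw⟩ := hb
  · rfl
  · exact absurd (hbw.trans haw.symm) (h.free b hb)
  · exact absurd (haw.trans hbw.symm) (h.free a ha)
  · exact hM.eq_of_worker_eq ha hb (haw.trans hbw.symm)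

/-- The witness set of a rejected contract is already full, so a contract that fits cannot lie in
it; all witnesses stay as they are. -/
theorem DAInv.accept (h : I.DAInv M R) (hc : I.Candidate M R e)
    (hbest : ∀ x, (I.wPref (I.worker e)).Prefers x e → x ∈ R) (hfeas : I.Feasible (insert e M)) :
    I.DAInv (insert e M) R where
  matching := by
    refine isMatching_iff.mpr ⟨?_, hc.worker_le h.matching, hfeas⟩
    intro x hx
    rcases Finset.mem_insert.mp hx with rfl | hx
    · by_contra hacc
      exact hc.notMem (h.unacceptable x hacc)
    · exact h.matching.acceptable x hx
  disjoint x hx := by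
    rcases Finset.mem_insert.mp hx with rfl | hx
    · exact hc.notMem
    · exact h.disjoint x hx
  unacceptable := h.unacceptable
  better x hx := by
    rcases Finset.mem_insert.mp hx with rfl | hx
    · exact hbest
    · exact h.better x hx
  not_stable := h.not_stable
  dominated r hr hacc := by
    obtain ⟨L, hrL, hq, hp⟩ := h.dominated r hr hacc
    have heL : e ∉ L.1 := by
      intro heL
      have := hfeas _ L
      rw [Finset.insert_inter_of_mem heL, Finset.card_insert_of_notMem] at this
      · omega
      · exact fun h' => hc.notMem_left (Finset.mem_inter.mp h').1
    refine ⟨L, hrL, ?_⟩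
    rw [Finset.insert_inter_of_notMem heL]
    exact ⟨hq, hp⟩

/-- In `insert e M` the set `L` is a smallest one over its quota, and `e'` is its least preferred
contract. -/
structure Overfull (I : Market nW nF nE) (M : Finset (Fin nE)) (e e' : Fin nE) (f : Fin nF)
    (L : {L // L ∈ I.lam f}) : Prop where
  exceeds : I.quota f L < (insert e M ∩ L.1).card
  smallest : ∀ L' : {L // L ∈ I.lam f}, I.quota f L' < (insert e M ∩ L'.1).card →
    L.1.card ≤ L'.1.card
  mem : e' ∈ insert e M ∩ L.1
  worst : ∀ x ∈ insert e M ∩ L.1, x ≠ e' → (I.fPref f).Prefers x e'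

/-- Before `e` was added the quota held, and one contract raises the count by at most one. -/
theorem over_mem {L : {L // L ∈ I.lam f}} (hM : I.Feasible M)
    (h : I.quota f L < (insert e M ∩ L.1).card) :
    e ∈ L.1 ∧ (insert e M ∩ L.1).card = I.quota f L + 1 := by
  have h1 := hM f L
  have h2 := card_insert_inter_le M L.1 e
  refine ⟨?_, by omega⟩
  by_contra he
  rw [Finset.insert_inter_of_notMem he] at h
  omega

theorem Overfull.card_erase {L : {L // L ∈ I.lam f}} (h : I.Overfull M e e' f L)
    (hM : I.Feasible M) : ((insert e M).erase e' ∩ L.1).card = I.quota f L := by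
  rw [Finset.erase_inter, Finset.card_erase_of_mem h.mem, (over_mem hM h.exceeds).2]
  rfl

theorem Overfull.prefers {L : {L // L ∈ I.lam f}} (h : I.Overfull M e e' f L) :
    ∀ x ∈ (insert e M).erase e' ∩ L.1, (I.fPref f).Prefers x e' := by
  intro x hx
  rw [Finset.erase_inter, Finset.mem_erase] at hx
  exact h.worst x hx.2 hx.1

/-- All overfull sets contain `e`, hence are nested, and `L` is a smallest one. -/
theorem Overfull.subset {L : {L // L ∈ I.lam f}} (h : I.Overfull M e e' f L)
    (hM : I.Feasible M) {L' : {L // L ∈ I.lam f}} (h' : I.quota f L' < (insert e M ∩ L'.1).card) :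
    L.1 ⊆ L'.1 := by
  rcases I.laminar f L.1 L.2 L'.1 L'.2 with hs | hs | hs
  · exact hs
  · exact (Finset.eq_of_subset_of_card_le hs (h.smallest L' h')).ge
  · exact absurd (over_mem hM h').1 (Finset.disjoint_left.mp hs (over_mem hM h.exceeds).1)

/-- Every overfull set exceeds its quota by exactly one and contains `L`, hence `e'`; removing this
single contract repairs all of them. -/
theorem Overfull.feasible {L : {L // L ∈ I.lam f}} (h : I.Overfull M e e' f L)
    (hM : I.Feasible M) : I.Feasible ((insert e M).erase e') := by
  intro f' L'
  by_contra hc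
  push Not at hc
  have h' : I.quota f' L' < (insert e M ∩ L'.1).card :=
    hc.trans_le (Finset.card_le_card
      (Finset.inter_subset_inter_right (Finset.erase_subset _ _)))
  have hf : f = f' := by
    rw [← I.lam_sub f L.1 L.2 e (over_mem hM h.exceeds).1, I.lam_sub f' L'.1 L'.2 e (over_mem hM h').1]
  subst hf
  have he' := h.subset hM h' (Finset.mem_inter.mp h.mem).2
  rw [Finset.erase_inter, Finset.card_erase_of_mem
    (Finset.mem_inter.mpr ⟨(Finset.mem_inter.mp h.mem).1, he'⟩), (over_mem hM h').2] at hc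
  omega

/-- No stable matching contains the contract that is about to be rejected. -/
theorem Overfull.notMem_stable {L : {L // L ∈ I.lam f}} (h : I.Overfull M e e' f L)
    (hI : I.Strict) (hinv : I.DAInv M R) (hc : I.Candidate M R e)
    (hbest : ∀ x, (I.wPref (I.worker e)).Prefers x e → x ∈ R) {N : Finset (Fin nE)}
    (hN : I.IsStable N) : e' ∉ N := by
  intro he'N
  have hM := hinv.matching.feasible
  have he'L := (Finset.mem_inter.mp h.mem).2
  have hfe' := I.lam_sub f L.1 L.2 e' he'L
  set T := (insert e M).erase e' with hT
  -- If `N` contained `e'`, this would contradict the quota: the left side equals the quota of `L`,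
  -- the right side is one less than the number of contracts of `N` in `L`.
  have hle : (T ∩ L.1).card ≤ ((N ∩ L.1).erase e').card := by
    refine card_le_of_tight (I := I) fun x hx hxN => ?_
    have hxe' := h.prefers x hx
    rw [Finset.mem_inter] at hx
    have hxN' : x ∉ N := by
      intro hxN'
      exact hxN (Finset.mem_erase.mpr ⟨(Finset.mem_erase.mp hx.1).1,
        Finset.mem_inter.mpr ⟨hxN', hx.2⟩⟩)
    have hxM := (Finset.mem_erase.mp hx.1).2
    have hfx := I.lam_sub f L.1 L.2 x hx.2
    -- Whatever the worker prefers to `x` is rejected and so not in `N`; hence she wants `x`, and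
    -- only the firm can prevent it from blocking `N`.
    have hxbest : ∀ y, (I.wPref (I.worker x)).Prefers y x → y ∈ R := by
      rcases Finset.mem_insert.mp hxM with rfl | hxM
      · exact hbest
      · exact hinv.better x hxM
    have hxacc : I.Acceptable x := by
      by_contra hxacc
      have hxR := hinv.unacceptable x hxacc
      rcases Finset.mem_insert.mp hxM with rfl | hxM
      · exact hc.notMem hxR
      · exact hinv.disjoint x hxM hxR
    have hfree : I.FreeForWorker N x := by
      refine ⟨hxacc, ?_⟩
      rcases (I.ofWorker N (I.worker x)).eq_empty_or_nonempty with h0 | ⟨y, hy⟩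
      · exact Or.inl h0
      · refine Or.inr ⟨y, hy, ?_⟩
        rw [mem_ofWorker] at hy
        have hyacc := hN.1.acceptable y hy.1
        rw [Acceptable, hy.2] at hyacc
        refine (hI.worker _ x y hxacc hyacc fun h => hxN' (h ▸ hy.1)).resolve_right fun hyx => ?_
        exact hinv.not_stable y (hxbest y hyx) N hN hy.1
    have hfirm : ¬ I.FreeForFirm N x := fun hf => hN.2 x ⟨hxN', hfree, hf⟩
    rw [freeForFirm_iff] at hfirm
    have hsw := (not_or.mp hfirm).2
    push Not at hsw
    -- The firm prefers `x` to `e'`, so the exchange must be infeasible. The set `L'` violated by it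
    -- avoids `e'`, contains `x` and is filled by `N`; by laminarity it lies inside `L`.
    obtain ⟨L', hL'⟩ := hsw e' he'N (by rw [hfx]; exact hxe')
    subst hfx
    have hqN := hN.1.feasible _ L'
    have he'L' : e' ∉ L'.1 := by
      intro he'L'
      have hmem : e' ∈ insert x N ∩ L'.1 :=
        Finset.mem_inter.mpr ⟨Finset.mem_insert_of_mem he'N, he'L'⟩
      rw [Finset.erase_inter, Finset.card_erase_of_mem hmem] at hL'
      have := card_insert_inter_le N L'.1 x
      omega
    rw [Finset.erase_inter, Finset.erase_eq_of_notMem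
      (fun h' => he'L' (Finset.mem_inter.mp h').2)] at hL'
    have hxL' : x ∈ L'.1 := (over_mem hN.1.feasible hL').1
    have hqe := (over_mem hN.1.feasible hL').2
    rw [Finset.insert_inter_of_mem hxL', Finset.card_insert_of_notMem
      (fun h' => hxN' (Finset.mem_inter.mp h').1)] at hqe
    have hsub : L'.1 ⊆ L.1 := by
      rcases I.laminar _ L'.1 L'.2 L.1 L.2 with hs | hs | hs
      · exact hs
      · exact absurd (hs he'L) he'L'
      · exact absurd hx.2 (Finset.disjoint_left.mp hs hxL')
    refine ⟨_, L'.1, L'.2, hxL', ?_⟩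
    have h1 : (N ∩ L.1).erase e' ∩ L'.1 = N ∩ L'.1 := by
      ext z
      simp only [Finset.mem_inter, Finset.mem_erase]
      constructor
      · rintro ⟨⟨-, hz, -⟩, hz'⟩
        exact ⟨hz, hz'⟩
      · rintro ⟨hz, hz'⟩
        exact ⟨⟨fun h => he'L' (h ▸ hz'), hz, hsub hz'⟩, hz'⟩
    rw [h1]
    have h2 : (T ∩ L'.1).card ≤ _ := h.feasible hM _ L'
    have h3 : (T ∩ L.1 ∩ L'.1).card ≤ (T ∩ L'.1).card :=
      Finset.card_le_card (Finset.inter_subset_inter_right Finset.inter_subset_left)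
    omega
  rw [h.card_erase hM, Finset.card_erase_of_mem (Finset.mem_inter.mpr ⟨he'N, he'L⟩)] at hle
  have h1 := hN.1.feasible f L
  have h2 : 0 < (N ∩ L.1).card := Finset.card_pos.mpr ⟨e', Finset.mem_inter.mpr ⟨he'N, he'L⟩⟩
  omega

/-- The delicate invariant is domination of an earlier rejected contract `r` with witness `L'`. If
`e` enters `L'`, then `L'` contains `L` and loses `e'`, so it stays full, and `e` is preferred to
`r` through `e'`. If only `e'` leaves `L'`, then `L'` lies in `L`, and `L` becomes the new witness.
-/
theorem DAInv.reject (hinv : I.DAInv M R) (hI : I.Strict) (hc : I.Candidate M R e)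
    (hbest : ∀ x, (I.wPref (I.worker e)).Prefers x e → x ∈ R) {L : {L // L ∈ I.lam f}}
    (h : I.Overfull M e e' f L) :
    I.DAInv ((insert e M).erase e') (insert e' R) where
  matching := by
    refine isMatching_iff.mpr ⟨?_, fun w => ?_, h.feasible hinv.matching.feasible⟩
    · intro x hx
      rcases Finset.mem_insert.mp (Finset.mem_of_mem_erase hx) with rfl | hx
      · by_contra hacc
        exact hc.notMem (hinv.unacceptable x hacc)
      · exact hinv.matching.acceptable x hx
    · refine le_trans (Finset.card_le_card ?_) (hc.worker_le hinv.matching w)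
      exact Finset.filter_subset_filter _ (Finset.erase_subset _ _)
  disjoint x hx := by
    rw [Finset.mem_erase, Finset.mem_insert] at hx
    rw [Finset.mem_insert, not_or]
    refine ⟨hx.1, ?_⟩
    rcases hx.2 with rfl | hx
    · exact hc.notMem
    · exact hinv.disjoint x hx
  unacceptable x hx := Finset.mem_insert_of_mem (hinv.unacceptable x hx)
  better x hx y hy := by
    refine Finset.mem_insert_of_mem ?_
    rcases Finset.mem_insert.mp (Finset.mem_of_mem_erase hx) with rfl | hx
    · exact hbest y hy
    · exact hinv.better x hx y hy
  not_stable r hr N hN := by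
    rcases Finset.mem_insert.mp hr with rfl | hr
    · exact h.notMem_stable hI hinv hc hbest hN
    · exact hinv.not_stable r hr N hN
  dominated r hr hacc := by
    have hM := hinv.matching.feasible
    have he'L := (Finset.mem_inter.mp h.mem).2
    have heL := (over_mem hM h.exceeds).1
    have hq := h.card_erase hM
    rcases Finset.mem_insert.mp hr with rfl | hr
    · have := I.lam_sub f L.1 L.2 r he'L
      subst this
      exact ⟨L, he'L, hq.ge, h.prefers⟩
    obtain ⟨L', hrL', hq', hp'⟩ := hinv.dominated r hr hacc
    by_cases hout : e ∉ L'.1 ∧ e' ∉ L'.1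
    · refine ⟨L', hrL', ?_⟩
      rw [Finset.erase_inter, Finset.insert_inter_of_notMem hout.1,
        Finset.erase_eq_of_notMem fun h' => hout.2 (Finset.mem_inter.mp h').2]
      exact ⟨hq', hp'⟩
    have hf : I.firm r = f := by
      by_contra hne
      refine hout ⟨fun h' => hne ?_, fun h' => hne ?_⟩
      · rw [← I.lam_sub _ L'.1 L'.2 e h', I.lam_sub f L.1 L.2 e heL]
      · rw [← I.lam_sub _ L'.1 L'.2 e' h', I.lam_sub f L.1 L.2 e' he'L]
    subst hf
    by_cases heq : e' = e
    · subst heq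
      refine ⟨L', hrL', ?_⟩
      rw [Finset.erase_insert hc.notMem_left]
      exact ⟨hq', hp'⟩
    by_cases heL' : e ∈ L'.1
    · have hover : I.quota _ L' < (insert e M ∩ L'.1).card := by
        rw [Finset.insert_inter_of_mem heL', Finset.card_insert_of_notMem
          fun h' => hc.notMem_left (Finset.mem_inter.mp h').1]
        omega
      have hsub := h.subset hM hover
      have he'L' := hsub he'L
      have he'M : e' ∈ M := (Finset.mem_insert.mp (Finset.mem_inter.mp h.mem).1).resolve_left heq
      have hpr : (I.fPref (I.firm r)).Prefers e' r := hp' e' (Finset.mem_inter.mpr ⟨he'M, he'L'⟩)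
      refine ⟨L', hrL', ?_, ?_⟩
      · rw [Finset.erase_inter, Finset.card_erase_of_mem (Finset.mem_inter.mpr
          ⟨Finset.mem_insert_of_mem he'M, he'L'⟩)]
        omega
      · intro x hx
        rw [Finset.mem_inter, Finset.mem_erase, Finset.mem_insert] at hx
        obtain ⟨⟨hxe', rfl | hxM⟩, hxL'⟩ := hx
        · exact (h.worst x (Finset.mem_inter.mpr ⟨Finset.mem_insert_self _ _, heL⟩) hxe').trans hpr
        · exact hp' x (Finset.mem_inter.mpr ⟨hxM, hxL'⟩)
    · have he'L' : e' ∈ L'.1 := by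
        by_contra he'L'
        exact hout ⟨heL', he'L'⟩
      have he'M : e' ∈ M := (Finset.mem_insert.mp (Finset.mem_inter.mp h.mem).1).resolve_left heq
      have hpr : (I.fPref (I.firm r)).Prefers e' r := hp' e' (Finset.mem_inter.mpr ⟨he'M, he'L'⟩)
      have hsub : L'.1 ⊆ L.1 := by
        rcases I.laminar _ L'.1 L'.2 L.1 L.2 with hs | hs | hs
        · exact hs
        · exact absurd (hs heL) heL'
        · exact absurd he'L (Finset.disjoint_left.mp hs he'L')
      exact ⟨L, hsub hrL', hq.ge, fun x hx => (h.prefers x hx).trans hpr⟩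

theorem exists_overfull (hI : I.Strict) (h : ¬ I.Feasible (insert e M)) :
    ∃ e' f L, I.Overfull M e e' f L := by
  classical
  simp only [Feasible] at h
  push Not at h
  obtain ⟨f, L₀, hL₀⟩ := h
  obtain ⟨L, hL, hmin⟩ := Finset.exists_min_image
    (Finset.univ.filter fun L : {L // L ∈ I.lam f} => I.quota f L < (insert e M ∩ L.1).card)
    (fun L => L.1.card) ⟨L₀, by simpa using hL₀⟩
  have hL' := (Finset.mem_filter.mp hL).2
  obtain ⟨e', he', hmax⟩ := Finset.exists_max_image (insert e M ∩ L.1) (I.fPref f).rank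
    (Finset.card_pos.mp (by omega))
  refine ⟨e', f, L, hL', fun L' h' => hmin L' (by simpa using h'), he', fun x hx hne => ?_⟩
  have hmem : ∀ y ∈ insert e M ∩ L.1, (I.fPref f).Mem y := fun y hy =>
    (I.fPref_iff f y).mpr (I.lam_sub f L.1 L.2 y (Finset.mem_inter.mp hy).2)
  refine (hI.firm f x e' (hmem x hx) (hmem e' he') hne).resolve_right fun h' => ?_
  exact absurd (hmax x hx) (not_le.mpr h'.2.2)

/-- Each round enlarges `M ∪ R` by exactly `e`: a rejected contract merely moves from the tentative
matching to `R`. -/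
theorem DAInv.exists_isWorkerOptimal (hI : I.Strict) (h : I.DAInv M R) :
    ∃ M', I.IsWorkerOptimal M' := by
  classical
  induction hm : nE - (M ∪ R).card using Nat.strong_induction_on generalizing M R with
  | _ m ih =>
    subst hm
    by_cases hdone : ∀ e, ¬ I.Candidate M R e
    · exact ⟨M, h.isWorkerOptimal hdone⟩
    push Not at hdone
    obtain ⟨e₀, he₀⟩ := hdone
    -- A better contract of the same worker, if not rejected, would itself be a candidate; a
    -- candidate of minimal rank therefore has only rejected contracts above it.
    obtain ⟨e, he, hmin⟩ := Finset.exists_min_image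
      (Finset.univ.filter fun x => I.Candidate M R x ∧ I.worker x = I.worker e₀)
      (I.wPref (I.worker e₀)).rank ⟨e₀, by simpa using he₀⟩
    rw [Finset.mem_filter] at he
    obtain ⟨-, hc, hw⟩ := he
    have hbest : ∀ x, (I.wPref (I.worker e)).Prefers x e → x ∈ R := by
      intro x hx
      by_contra hxR
      have hxw := I.wPref_sub _ x hx.1
      rw [hw] at hx hxw
      have := hmin x (by
        simp only [Finset.mem_filter, Finset.mem_univ, true_and]
        refine ⟨⟨hxR, fun y hy => ?_⟩, hxw⟩
        rw [hxw]
        exact hw ▸ hc.free y hy)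
      exact absurd hx.2.2 (not_lt.mpr this)
    have hnot : e ∉ M ∪ R := by
      rw [Finset.mem_union, not_or]
      exact ⟨hc.notMem_left, hc.notMem⟩
    have hlt : (insert e (M ∪ R)).card ≤ nE := by
      simpa using Finset.card_le_univ (insert e (M ∪ R))
    rw [Finset.card_insert_of_notMem hnot] at hlt
    by_cases hfeas : I.Feasible (insert e M)
    · refine ih _ ?_ (h.accept hc hbest hfeas) rfl
      rw [Finset.insert_union, Finset.card_insert_of_notMem hnot]
      omega
    · obtain ⟨e', f, L, hL⟩ := exists_overfull hI hfeas
      refine ih _ ?_ (h.reject hI hc hbest hL) rfl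
      have hmem := (Finset.mem_inter.mp hL.mem).1
      rw [Finset.union_insert, ← Finset.insert_union, Finset.insert_erase hmem,
        Finset.insert_union, Finset.card_insert_of_notMem hnot]
      omega

theorem Strict.exists_isWorkerOptimal (hI : I.Strict) : ∃ M, I.IsWorkerOptimal M :=
  (daInv_empty I).exists_isWorkerOptimal hI

end Step

/-! ### Strategy-proofness and return to the market with ties -/

section StrategyProof

variable {I : Market nW nF nE} {M N : Finset (Fin nE)} {e e' : Fin nE} {w : Fin nW}

theorem Strict.replaceList {P : PrefList nE} {hP : ∀ e, P.Mem e → I.worker e = w} (hI : I.Strict)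
    (h : P.Strict) : (I.replaceList w P hP).Strict where
  worker v := by
    by_cases hv : v = w
    · subst hv
      simpa [Market.replaceList] using h
    · simpa [Market.replaceList, hv] using hI.worker v
  firm := hI.firm

theorem replaceList_breakTies (P : PrefList nE) (hP : ∀ e, P.Mem e → I.worker e = w) :
    (I.replaceList w P hP).breakTies = I.breakTies.replaceList w P.breakTies
      fun e h => hP e ((P.mem_breakTies e).mp h) := by
  simp only [breakTies, replaceList]
  congr 1
  funext v
  by_cases hv : v = w
  · subst hv
    simp
  · simp [hv]

variable {P P' : PrefList nE} {hP : ∀ e, P.Mem e → I.worker e = w}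
  {hP' : ∀ e, P'.Mem e → I.worker e = w}

theorem acceptable_replaceList : (I.replaceList w P hP).Acceptable e ↔
    if I.worker e = w then P.Mem e else I.Acceptable e := by
  simp only [Acceptable, replaceList, Function.update_apply]
  split_ifs <;> rfl

theorem freeForWorker_replaceList_of_ne (h : I.worker e ≠ w) :
    (I.replaceList w P hP).FreeForWorker N e ↔ I.FreeForWorker N e := by
  simp only [FreeForWorker, acceptable_replaceList, h, if_false]
  simp only [replaceList, Function.update_of_ne h]
  rfl

theorem freeForWorker_replaceList_of_eq (h : I.worker e = w) :
    (I.replaceList w P hP).FreeForWorker N e ↔ P.Mem e ∧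
      (I.ofWorker N w = ∅ ∨ ∃ e' ∈ I.ofWorker N w, P.Prefers e e') := by
  simp only [FreeForWorker, acceptable_replaceList, h, if_true]
  subst h
  simp only [replaceList, Function.update_self]
  rfl

/-- Stability carries over from one report of `w` to another one if the contract of `w` is still
acceptable and no contract has become more attractive. -/
theorem IsStable.replaceList (hN : (I.replaceList w P hP).IsStable N)
    (hmem : ∀ e ∈ N, I.worker e = w → P'.Mem e)
    (hfree : ∀ e ∉ N, I.worker e = w → (I.replaceList w P' hP').FreeForWorker N e →
      (I.replaceList w P hP).FreeForWorker N e) :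
    (I.replaceList w P' hP').IsStable N := by
  refine ⟨⟨?_, hN.1.worker_le, hN.1.firm_feasible⟩, ?_⟩
  · intro e he
    have := hN.1.acceptable e he
    rw [acceptable_replaceList] at this ⊢
    split_ifs with h
    · exact hmem e he h
    · simpa [h] using this
  · rintro e ⟨heN, hw, hf⟩
    refine hN.2 e ⟨heN, ?_, hf⟩
    by_cases h : I.worker e = w
    · exact hfree e heN h hw
    · rw [freeForWorker_replaceList_of_ne h] at hw ⊢
      exact hw

theorem replaceList_self : I.replaceList w (I.wPref w) (I.wPref_sub w) = I := by
  simp [replaceList]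

/-- In a market without ties no worker gains by misreporting if the outcome is worker-optimal. -/
theorem IsWorkerOptimal.weaklyPrefers_replaceList (hI : I.Strict) (hM : I.IsWorkerOptimal M)
    (hN : (I.replaceList w P hP).IsStable N) : I.WeaklyPrefers w M N := by
  by_cases hex : ∃ e ∈ I.ofWorker N w, (I.wPref w).Mem e
  swap
  · exact Or.inl hex
  obtain ⟨e, he, hew⟩ := hex
  rw [mem_ofWorker] at he
  have huniq : ∀ x ∈ N, I.worker x = w → x = e := fun x hx hxw =>
    hN.1.eq_of_worker_eq hx he.1 (hxw.trans he.2.symm)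
  have hP₂ : ∀ x, (PrefList.single e).Mem x → I.worker x = w := by
    intro x hx
    rw [PrefList.mem_single] at hx
    rw [hx, he.2]
  -- Ranks start at 0, so this truncation keeps `e` itself and drops everything worse.
  have hP₃ : ∀ x, ((I.wPref w).truncate ((I.wPref w).rank e + 1)).Mem x → I.worker x = w :=
    fun x hx => I.wPref_sub w x (PrefList.mem_truncate.mp hx).1
  -- The only contract acceptable to `w` under this report is `e`, which is in `N` and so cannot
  -- block.
  have hN₂ : (I.replaceList w (PrefList.single e) hP₂).IsStable N := by
    refine hN.replaceList (fun x hx hxw => PrefList.mem_single.mpr (huniq x hx hxw)) ?_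
    intro x hx hxw h
    rw [freeForWorker_replaceList_of_eq hxw, PrefList.mem_single] at h
    exact absurd he.1 (h.1 ▸ hx)
  obtain ⟨O, hO⟩ := (hI.replaceList (hP := hP₂) (PrefList.strict_single e)).exists_isWorkerOptimal
  obtain ⟨M₃, hM₃⟩ :=
    (hI.replaceList (hP := hP₃) ((hI.worker w).truncate _)).exists_isWorkerOptimal
  have hmatched : ∃ x ∈ M₃, I.worker x = w := by
    by_contra hc
    push Not at hc
    have hempty : I.ofWorker M₃ w = ∅ := by
      rw [Finset.eq_empty_iff_forall_notMem]
      intro x hx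
      rw [mem_ofWorker] at hx
      exact hc x hx.1 hx.2
    -- Among the contracts of `w` only `e` could block under the one-entry report, and it would
    -- already block under the truncated list. But `O` assigns `w`, so every stable matching for
    -- that report must.
    have hM₂ : (I.replaceList w (PrefList.single e) hP₂).IsStable M₃ := by
      refine hM₃.1.replaceList (fun x hx hxw => absurd hxw (hc x hx)) ?_
      intro x hx hxw h
      rw [freeForWorker_replaceList_of_eq hxw, PrefList.mem_single] at h
      rw [freeForWorker_replaceList_of_eq hxw, h.1, PrefList.mem_truncate]
      exact ⟨⟨hew, Nat.lt_succ_self _⟩, Or.inl hempty⟩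
    obtain ⟨y, hy, -, -⟩ := hN₂.1.exists_of_weaklyPrefers (hO.2 N hN₂ w)
      (mem_ofWorker.mpr he)
    rw [mem_ofWorker] at hy
    obtain ⟨z, hz, hzy⟩ := exists_mem_of_isWorkerOptimal
      (hI.replaceList (PrefList.strict_single e)) hO hM₂ hy.1
    exact hc z hz (hzy.trans hy.2)
  obtain ⟨e₃, he₃, he₃w⟩ := hmatched
  have he₃mem := hM₃.1.1.acceptable e₃ he₃
  rw [acceptable_replaceList, if_pos he₃w, PrefList.mem_truncate] at he₃mem
  -- Restoring the dropped tail adds only contracts worse than `e₃`, which cannot block.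
  have hM₃' : I.IsStable M₃ := by
    rw [← I.replaceList_self (w := w)]
    refine hM₃.1.replaceList (fun x hx hxw => ?_) ?_
    · have := hM₃.1.1.acceptable x hx
      rw [acceptable_replaceList, if_pos hxw, PrefList.mem_truncate] at this
      exact this.1
    · intro x hx hxw h
      rw [freeForWorker_replaceList_of_eq hxw] at h ⊢
      rcases h.2 with h' | ⟨y, hy, hxy⟩
      · exact absurd (mem_ofWorker.mpr ⟨he₃, he₃w⟩) (by simp [h'])
      · have hy' := mem_ofWorker.mp hy
        have hye : y = e₃ := hM₃.1.1.eq_of_worker_eq hy'.1 he₃ (hy'.2.trans he₃w.symm)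
        have hyr : (I.wPref w).rank y < (I.wPref w).rank e + 1 := hye ▸ he₃mem.2
        exact ⟨PrefList.mem_truncate.mpr ⟨h.1, hxy.2.2.trans hyr⟩,
          Or.inr ⟨y, hy, PrefList.prefers_truncate.mpr ⟨hxy, hyr⟩⟩⟩
  obtain ⟨m, hm, hmw, hme⟩ := hM₃'.1.exists_of_weaklyPrefers (hM.2 M₃ hM₃' w)
    (mem_ofWorker.mpr ⟨he₃, he₃w⟩)
  refine Or.inr ⟨m, hm, e, mem_ofWorker.mpr he, hmw, hew, fun hem => hme ⟨he₃mem.1, hmw, ?_⟩⟩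
  have h1 := hem.2.2
  have h2 := he₃mem.2
  omega

/-- Strict preferences survive tie-breaking, so a contract blocking with ties also blocks without
them. -/
theorem IsStable.of_breakTies (h : I.breakTies.IsStable M) : I.IsStable M := by
  have hacc : ∀ x, I.breakTies.Acceptable x ↔ I.Acceptable x :=
    fun x => (I.wPref (I.worker x)).mem_breakTies x
  refine ⟨⟨fun e he => (hacc e).mp (h.1.acceptable e he), h.1.worker_le, h.1.firm_feasible⟩, ?_⟩
  rintro e ⟨heM, ⟨hea, hw⟩, hf⟩
  refine h.2 e ⟨heM, ⟨(hacc e).mpr hea, hw.imp id ?_⟩, hf.imp id ?_⟩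
  · rintro ⟨x, hx, hp⟩
    exact ⟨x, hx, hp.breakTies⟩
  · rintro ⟨x, hx, hp, hr⟩
    exact ⟨x, hx, hp.breakTies, hr⟩

theorem WeaklyPrefers.of_breakTies (h : I.breakTies.WeaklyPrefers w M N) :
    I.WeaklyPrefers w M N := by
  rcases h with h | ⟨x, hx, y, hy, hx', hy', hp⟩
  · refine Or.inl fun ⟨x, hx, hx'⟩ => h ⟨x, hx, ?_⟩
    exact ((I.wPref w).mem_breakTies x).mpr hx'
  · exact Or.inr ⟨x, hx, y, hy, ((I.wPref w).mem_breakTies x).mp hx',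
      ((I.wPref w).mem_breakTies y).mp hy', fun h => hp h.breakTies⟩

end StrategyProof

end Market

end OLC

/-! ### Reasoning about programs -/

namespace OLC

namespace State

@[simp] theorem setVar_var (σ : State) (x v y : ℕ) :
    (σ.setVar x v).var y = if y = x then v else σ.var y := by
  simp [setVar, Function.update_apply]

@[simp] theorem setVar_arr (σ : State) (x v : ℕ) : (σ.setVar x v).arr = σ.arr := rfl

@[simp] theorem setArr_var (σ : State) (a i v : ℕ) : (σ.setArr a i v).var = σ.var := rfl

@[simp] theorem setArr_arr (σ : State) (a i v b j : ℕ) :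
    (σ.setArr a i v).arr b j = if b = a ∧ j = i then v else σ.arr b j := by
  by_cases h : b = a
  · subst h
    simp [setArr, Function.update_apply]
  · simp [setArr, h]

end State

/-! ### Weakest preconditions with running time -/

/-- The program `p` halts from `σ` in a state and after a number of steps that satisfy `Q`. -/
def WP (p : Program) (σ : State) (Q : State → ℕ → Prop) : Prop :=
  ∃ σ' t, Run p σ σ' t ∧ Q σ' t

namespace WP

variable {p q : Program} {σ : State} {Q Q' : State → ℕ → Prop} {b : Expr}

theorem mono (h : WP p σ Q) (hQ : ∀ τ t, Q τ t → Q' τ t) : WP p σ Q' := by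
  obtain ⟨τ, t, hr, hq⟩ := h
  exact ⟨τ, t, hr, hQ τ t hq⟩

theorem skip (h : Q σ 1) : WP .skip σ Q := ⟨_, _, .skip σ, h⟩

theorem assign {x : ℕ} {v : Expr} (h : Q (σ.setVar x (v.eval σ)) (v.cost + 1)) :
    WP (.assign x v) σ Q := ⟨_, _, .assign σ x v, h⟩

theorem write {a : ℕ} {i v : Expr}
    (h : Q (σ.setArr a (i.eval σ) (v.eval σ)) (i.cost + v.cost + 1)) :
    WP (.write a i v) σ Q := ⟨_, _, .write σ a i v, h⟩

theorem seq (h : WP p σ fun τ t => WP q τ fun τ' t' => Q τ' (t + t')) : WP (.seq p q) σ Q := by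
  obtain ⟨τ, t, hr, τ', t', hr', hq⟩ := h
  exact ⟨τ', _, .seq hr hr', hq⟩

theorem ite (h : b.eval σ ≠ 0 → WP p σ fun τ t => Q τ (b.cost + 1 + t))
    (h' : b.eval σ = 0 → WP q σ fun τ t => Q τ (b.cost + 1 + t)) : WP (.ite b p q) σ Q := by
  by_cases hb : b.eval σ = 0
  · obtain ⟨τ, t, hr, hq⟩ := h' hb
    exact ⟨τ, _, .ite_false hb hr, hq⟩
  · obtain ⟨τ, t, hr, hq⟩ := h hb
    exact ⟨τ, _, .ite_true hb hr, hq⟩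

/-- Induction on the number of rounds left, where `n` is the exact number of rounds. The bound may
vary with the round, since scanning a set costs its size. -/
theorem loop (n : ℕ) (Inv : ℕ → State → Prop) (c : ℕ → ℕ) (h0 : Inv 0 σ)
    (hstep : ∀ i < n, ∀ τ, Inv i τ →
      b.eval τ ≠ 0 ∧ WP p τ fun τ' t => Inv (i + 1) τ' ∧ t ≤ c i)
    (hend : ∀ τ, Inv n τ → b.eval τ = 0) :
    WP (.loop b p) σ fun τ t =>
      Inv n τ ∧ t ≤ ∑ i ∈ Finset.range n, (c i + (b.cost + 1)) + (b.cost + 1) := by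
  have key : ∀ k i, i + k = n → ∀ τ, Inv i τ → WP (.loop b p) τ fun τ' t =>
      Inv n τ' ∧ t ≤ ∑ j ∈ Finset.range k, (c (i + j) + (b.cost + 1)) + (b.cost + 1) := by
    intro k
    induction k with
    | zero =>
      rintro i rfl τ hτ
      exact ⟨τ, _, .loop_false (hend τ hτ), hτ, by simp⟩
    | succ k ih =>
      intro i hi τ hτ
      obtain ⟨hb, τ₁, t₁, hr₁, hI₁, ht₁⟩ := hstep i (by omega) τ hτ
      obtain ⟨τ₂, t₂, hr₂, hI₂, ht₂⟩ := ih (i + 1) (by omega) τ₁ hI₁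
      refine ⟨τ₂, _, .loop_true hb hr₁ hr₂, hI₂, ?_⟩
      rw [Finset.sum_range_succ']
      have : ∀ j, i + 1 + j = i + (j + 1) := fun j => by omega
      simp only [this] at ht₂
      simp only [Nat.add_zero]
      omega
  simpa using key n 0 (by omega) σ h0

/-- A loop whose rounds have bounded running time. -/
theorem loop_const (n : ℕ) (Inv : ℕ → State → Prop) (c : ℕ) (h0 : Inv 0 σ)
    (hstep : ∀ i < n, ∀ τ, Inv i τ →
      b.eval τ ≠ 0 ∧ WP p τ fun τ' t => Inv (i + 1) τ' ∧ t ≤ c)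
    (hend : ∀ τ, Inv n τ → b.eval τ = 0) :
    WP (.loop b p) σ fun τ t => Inv n τ ∧ t ≤ n * (c + (b.cost + 1)) + (b.cost + 1) := by
  simpa using loop n Inv (fun _ => c) h0 hstep hend

end WP

/-! ### Frames -/

/-- The states differ at most in the variables `V` and the arrays `A`. -/
def Frame (V A : List ℕ) (σ τ : State) : Prop :=
  (∀ x, x ∉ V → τ.var x = σ.var x) ∧ ∀ a, a ∉ A → τ.arr a = σ.arr a

namespace Frame

variable {V V' A A' : List ℕ} {σ τ υ : State}

theorem refl (V A : List ℕ) (σ : State) : Frame V A σ σ := ⟨fun _ _ => rfl, fun _ _ => rfl⟩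

theorem trans (h : Frame V A σ τ) (h' : Frame V' A' τ υ) (hV : V' ⊆ V) (hA : A' ⊆ A) :
    Frame V A σ υ :=
  ⟨fun x hx => (h'.1 x fun hx' => hx (hV hx')).trans (h.1 x hx),
    fun a ha => (h'.2 a fun ha' => ha (hA ha')).trans (h.2 a ha)⟩

theorem mono (h : Frame V A σ τ) (hV : V ⊆ V') (hA : A ⊆ A') : Frame V' A' σ τ :=
  (refl V' A' σ).trans h hV hA

theorem setVar (h : Frame V A σ τ) {x : ℕ} (hx : x ∈ V) (v : ℕ) : Frame V A σ (τ.setVar x v) := by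
  refine ⟨fun y hy => ?_, h.2⟩
  have : y ≠ x := fun hyx => hy (hyx ▸ hx)
  simp [this, h.1 y hy]

theorem setArr (h : Frame V A σ τ) {a : ℕ} (ha : a ∈ A) (i v : ℕ) :
    Frame V A σ (τ.setArr a i v) := by
  refine ⟨h.1, fun b hb => ?_⟩
  have : b ≠ a := fun hba => hb (hba ▸ ha)
  funext j
  simp [this, h.2 b hb]

end Frame

/-! ### Linear search for a best element -/

/-- The number `r` codes the outcome of a search among the numbers below `i` that satisfy `P`: it
is 0 if there are none, and `x + 1` for an `x` that is minimal for `lt`. -/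
def Best (P : ℕ → Prop) (lt : ℕ → ℕ → Prop) (i r : ℕ) : Prop :=
  (r = 0 ∧ ∀ x < i, ¬ P x) ∨ ∃ e < i, r = e + 1 ∧ P e ∧ ∀ x < i, P x → ¬ lt x e

namespace Best

variable {P : ℕ → Prop} {lt : ℕ → ℕ → Prop} {i r : ℕ}

theorem zero (P : ℕ → Prop) (lt : ℕ → ℕ → Prop) : Best P lt 0 0 := Or.inl ⟨rfl, by simp⟩

theorem keep (h : Best P lt i r) (hP : P i → r ≠ 0 ∧ ¬ lt i (r - 1)) : Best P lt (i + 1) r := by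
  rcases h with ⟨rfl, h⟩ | ⟨e, he, rfl, hPe, h⟩
  · refine Or.inl ⟨rfl, fun x hx => ?_⟩
    rcases Nat.lt_succ_iff_lt_or_eq.mp hx with hx | rfl
    · exact h x hx
    · exact fun hPx => (hP hPx).1 rfl
  · refine Or.inr ⟨e, by omega, rfl, hPe, fun x hx hPx => ?_⟩
    rcases Nat.lt_succ_iff_lt_or_eq.mp hx with hx | rfl
    · exact h x hx hPx
    · exact (hP hPx).2

/-- Anything below the new element would, by transitivity, have been below the old one. -/
theorem change (htr : ∀ x y z, lt x y → lt y z → lt x z) (hirr : ∀ x, ¬ lt x x)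
    (h : Best P lt i r) (hP : P i) (hr : r ≠ 0 → lt i (r - 1)) : Best P lt (i + 1) (i + 1) := by
  refine Or.inr ⟨i, by omega, rfl, hP, fun x hx hPx => ?_⟩
  rcases Nat.lt_succ_iff_lt_or_eq.mp hx with hx | rfl
  · rcases h with ⟨rfl, h⟩ | ⟨e, he, rfl, hPe, h⟩
    · exact absurd hPx (h x hx)
    · exact fun hxi => h x hx hPx (htr x i e hxi (hr (Nat.succ_ne_zero e)))
  · exact hirr _

end Best

end OLC

/-! ### Memory layout and search routines -/

namespace OLC

variable {nW nF nE m : ℕ} {I : Market nW nF nE} {S : Fin m → Finset (Fin nE)} {σ τ : State}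
  {M R : Finset (Fin nE)}

/-- The state `σ` holds the instance `I`, whose nonempty laminar sets are listed by `S`. -/
structure Layout (I : Market nW nF nE) (S : Fin m → Finset (Fin nE)) (σ : State) : Prop where
  contracts : σ.var 0 = nE
  sets : σ.var 3 = m
  worker : ∀ e : Fin nE, σ.arr 0 e = I.worker e
  worker_acc : ∀ e : Fin nE, I.Acceptable e → σ.arr 2 e = (I.wPref (I.worker e)).rank e + 1
  worker_unacc : ∀ e : Fin nE, ¬ I.Acceptable e → σ.arr 2 e = 0
  firm_pos : ∀ e : Fin nE, σ.arr 3 e = (I.fPref (I.firm e)).rank e + 1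
  injective : Function.Injective S
  exists_iff : ∀ L, (∃ j, S j = L) ↔ L.Nonempty ∧ ∃ f, L ∈ I.lam f
  quota : ∀ j f (h : S j ∈ I.lam f), σ.arr 4 j = I.quota f ⟨S j, h⟩
  offset : ∀ j : Fin m, σ.arr 5 (j + 1) = σ.arr 5 j + (S j).card
  mem_iff : ∀ j e, e ∈ S j ↔ ∃ i < (S j).card, σ.arr 6 (σ.arr 5 j + i) = (e : ℕ)

theorem IsInput.exists_layout (h : IsInput I σ) :
    ∃ (m : ℕ) (S : Fin m → Finset (Fin nE)), Layout I S σ := by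
  obtain ⟨S, h1, h2, h3, -, h4, h5⟩ := h.families
  exact ⟨_, S, h.contracts, rfl, h.worker, h.worker_acc, h.worker_unacc, h.firm_pos, h1, h2, h3,
    h4, h5⟩

/-- The variables used by the program. -/
def workVars : List ℕ := [4, 5, 6, 7, 8, 9, 10, 11]

/-- The arrays used by the program. -/
def workArrs : List ℕ := [7, 8, 9]

/-- The program writes only to its work variables and arrays, which are disjoint from the input
described here. -/
theorem Layout.frame (h : Layout I S σ) (hf : Frame workVars workArrs σ τ) : Layout I S τ := by
  have hv0 := hf.1 0 (by decide)
  have hv3 := hf.1 3 (by decide)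
  have h0 := hf.2 0 (by decide)
  have h2 := hf.2 2 (by decide)
  have h3 := hf.2 3 (by decide)
  have h4 := hf.2 4 (by decide)
  have h5 := hf.2 5 (by decide)
  have h6 := hf.2 6 (by decide)
  refine ⟨hv0.trans h.contracts, hv3.trans h.sets, ?_, ?_, ?_, ?_, h.injective, h.exists_iff, ?_, ?_,
    ?_⟩
  · rw [h0]; exact h.worker
  · rw [h2]; exact h.worker_acc
  · rw [h2]; exact h.worker_unacc
  · rw [h3]; exact h.firm_pos
  · rw [h4]; exact h.quota
  · rw [h5]; exact h.offset
  · rw [h5, h6]; exact h.mem_iff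

/-- The state holds the tentative matching `M` and the rejected contracts `R`. -/
structure Holds (I : Market nW nF nE) (M R : Finset (Fin nE)) (σ : State) : Prop where
  matched : ∀ e : Fin nE, σ.arr 7 e = if e ∈ M then 1 else 0
  rejected : ∀ e : Fin nE, σ.arr 8 e = if e ∈ R then 1 else 0
  busy : ∀ e : Fin nE, σ.arr 9 (I.worker e) = if ∃ x ∈ M, I.worker x = I.worker e then 1 else 0

theorem Holds.frame {V : List ℕ} (h : Holds I M R σ) (hf : Frame V [] σ τ) : Holds I M R τ := by
  have h7 := hf.2 7 (by simp)
  have h8 := hf.2 8 (by simp)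
  have h9 := hf.2 9 (by simp)
  obtain ⟨a, b, c⟩ := h
  constructor <;> simp only [h7, h8, h9] <;> assumption

/-! ### Searching a proposal -/

/-- Searches the candidate with the smallest position in its worker's list. -/
def findCandidate : Program :=
  .seq (.assign 6 (.lit 0)) <| .seq (.assign 5 (.lit 0)) <|
  .loop (.sub (.var 0) (.var 5)) <|
    .seq
      (.ite (.add (.read 8 (.var 5)) (.read 9 (.read 0 (.var 5)))) .skip
        (.ite (.var 6)
          (.ite (.sub (.read 2 (.sub (.var 6) (.lit 1))) (.read 2 (.var 5)))
            (.assign 6 (.add (.var 5) (.lit 1))) .skip)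
          (.assign 6 (.add (.var 5) (.lit 1)))))
      (.assign 5 (.add (.var 5) (.lit 1)))

/-- The order by positions, smaller indices first. -/
def KeyLt (key : ℕ → ℕ) (a b : ℕ) : Prop := key a < key b ∨ key a = key b ∧ a < b

/-- Positions are compared across all workers; a global minimum is in particular minimal for its own
worker. The scan goes by increasing index and replaces only on a strictly smaller position, as
tie-breaking demands. -/
theorem findCandidate_spec (hL : Layout I S σ) (hH : Holds I M R σ) :
    WP findCandidate σ fun τ t => Frame [5, 6] [] σ τ ∧
      Best (fun x => ∃ e : Fin nE, (e : ℕ) = x ∧ I.Candidate M R e) (KeyLt (σ.arr 2)) nE (τ.var 6) ∧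
      t ≤ 40 * nE + 40 := by
  set P : ℕ → Prop := fun x => ∃ e : Fin nE, (e : ℕ) = x ∧ I.Candidate M R e with hP
  refine WP.seq (WP.assign (WP.seq (WP.assign ?_)))
  refine (WP.loop_const nE
    (fun i τ => τ.var 5 = i ∧ Frame [5, 6] [] σ τ ∧ Best P (KeyLt (σ.arr 2)) i (τ.var 6)) 30
    ?_ ?_ ?_).mono ?_
  · refine ⟨by simp [Expr.eval], ((Frame.refl _ _ σ).setVar (by simp) _).setVar (by simp) _, ?_⟩
    simpa [Expr.eval] using Best.zero P _
  · rintro i hi τ ⟨h5, hf, hb⟩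
    have hL' := hL.frame (hf.mono (V' := workVars) (A' := workArrs) (by decide) (by decide))
    have hH' := hH.frame hf
    have h2 := hf.2 2 (by simp)
    refine ⟨by simp only [Expr.eval, hL'.contracts, h5]; omega, ?_⟩
    have hw := hL'.worker ⟨i, hi⟩
    have hrej := hH'.rejected ⟨i, hi⟩
    have hbusy := hH'.busy ⟨i, hi⟩
    dsimp only at hw hrej hbusy
    -- Both flags are 0 or 1, so their sum acts as a disjunction.
    have hPi : P i ↔ τ.arr 8 i + τ.arr 9 (τ.arr 0 i) = 0 := by
      rw [hw, hrej, hbusy]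
      constructor
      · rintro ⟨e, rfl, hc⟩
        have h1 := hc.notMem
        have h2 : ¬ ∃ x ∈ M, I.worker x = I.worker e := by
          rintro ⟨x, hx, hxe⟩
          exact hc.free x hx hxe
        simp [h1, h2]
      · intro h
        refine ⟨⟨i, hi⟩, rfl, ⟨?_, ?_⟩⟩
        · intro h'
          simp [h'] at h
        · intro x hx hxe
          have hbusy' : ∃ x ∈ M, I.worker x = I.worker ⟨i, hi⟩ := ⟨x, hx, hxe⟩
          rw [if_pos hbusy'] at h
          omega
    have hlt : τ.var 6 ≠ 0 → τ.var 6 - 1 < i := by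
      intro h0
      rcases hb with ⟨h, -⟩ | ⟨e, he, h, -⟩ <;> omega
    have hchange : P i → (τ.var 6 ≠ 0 → KeyLt (σ.arr 2) i (τ.var 6 - 1)) →
        Best P (KeyLt (σ.arr 2)) (i + 1) (i + 1) :=
      hb.change (fun x y z => by unfold KeyLt; omega) (fun x => by unfold KeyLt; omega)
    refine WP.seq (WP.ite (fun hb' => WP.skip ?_) fun hb' => WP.ite (fun h6 => WP.ite
      (fun hl => WP.assign ?_) fun hl => WP.skip ?_) fun h6 => WP.assign ?_)
    all_goals
      refine WP.assign ?_
      try simp only [Expr.eval, h5] at hb'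
      try simp only [Expr.eval] at h6
      try simp only [Expr.eval, h5, h2] at hl
      simp only [Expr.eval, h5]
      refine ⟨⟨by simp [h5], ?_, ?_⟩, by simp [Expr.cost]⟩
    · exact hf.setVar (by simp) _
    · simp only [State.setVar_var]
      exact hb.keep fun h => absurd (hPi.mp h) hb'
    · exact (hf.setVar (by simp) _).setVar (by simp) _
    · simpa using hchange (hPi.mpr hb') fun _ => Or.inl (by omega)
    · exact hf.setVar (by simp) _
    · simp only [State.setVar_var]
      refine hb.keep fun _ => ⟨h6, ?_⟩
      have := hlt h6
      unfold KeyLt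
      omega
    · exact (hf.setVar (by simp) _).setVar (by simp) _
    · simpa using hchange (hPi.mpr hb') fun h => absurd h6 h
  · rintro τ ⟨h5, hf, -⟩
    have h0 := hf.1 0 (by simp)
    simp only [Expr.eval, h5, h0, hL.contracts]
    omega
  · rintro τ t ⟨⟨-, hf, hb⟩, ht⟩
    refine ⟨hf, hb, ?_⟩
    simp only [Expr.cost] at ht ⊢
    omega

/-! ### Counting the contracts in a laminar set -/

/-- The cells cover the set and are as many as its elements, so each element is listed exactly once;
summing over cells then counts without repetition. -/
theorem Layout.image_eq (hL : Layout I S σ) (j : Fin m) :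
    (Finset.range (S j).card).image (fun i => σ.arr 6 (σ.arr 5 j + i)) =
      (S j).map Fin.valEmbedding := by
  symm
  apply Finset.eq_of_subset_of_card_le
  · intro x hx
    obtain ⟨e, he, rfl⟩ := Finset.mem_map.mp hx
    obtain ⟨i, hi, h⟩ := (hL.mem_iff j e).mp he
    exact Finset.mem_image.mpr ⟨i, Finset.mem_range.mpr hi, h⟩
  · rw [Finset.card_map]
    exact Finset.card_image_le.trans (by simp)

theorem Layout.exists_elem (hL : Layout I S σ) (j : Fin m) {i : ℕ} (hi : i < (S j).card) :
    ∃ e ∈ S j, σ.arr 6 (σ.arr 5 j + i) = (e : ℕ) := by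
  have h := Finset.mem_image_of_mem (fun i => σ.arr 6 (σ.arr 5 j + i)) (Finset.mem_range.mpr hi)
  rw [hL.image_eq j] at h
  obtain ⟨e, he, h'⟩ := Finset.mem_map.mp h
  exact ⟨e, he, h'.symm⟩

theorem Layout.sum_eq (hL : Layout I S σ) (j : Fin m) (hM : ∀ e : Fin nE,
    σ.arr 7 e = if e ∈ M then 1 else 0) :
    ∑ i ∈ Finset.range (S j).card, σ.arr 7 (σ.arr 6 (σ.arr 5 j + i)) = (M ∩ S j).card := by
  have hinj : Set.InjOn (fun i => σ.arr 6 (σ.arr 5 j + i)) (Finset.range (S j).card) := by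
    apply Finset.injOn_of_card_image_eq
    rw [hL.image_eq j, Finset.card_map, Finset.card_range]
  rw [← Finset.sum_image (f := σ.arr 7) hinj, hL.image_eq j, Finset.sum_map]
  simp only [Fin.valEmbedding_apply, hM]
  rw [Finset.sum_boole, Finset.filter_mem_eq_inter, Finset.inter_comm]
  rfl

/-- Counts the contracts of the tentative matching in the set whose number is in variable 7. -/
def countSet : Program :=
  .seq (.assign 9 (.lit 0)) <| .seq (.assign 8 (.read 5 (.var 7))) <|
  .loop (.sub (.read 5 (.add (.var 7) (.lit 1))) (.var 8)) <|
    .seq (.assign 9 (.add (.var 9) (.read 7 (.read 6 (.var 8)))))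
      (.assign 8 (.add (.var 8) (.lit 1)))

theorem countSet_spec (hL : Layout I S σ)
    (hM : ∀ e : Fin nE, σ.arr 7 e = if e ∈ M then 1 else 0) (j : Fin m) (hj : σ.var 7 = j) :
    WP countSet σ fun τ t => Frame [8, 9] [] σ τ ∧ τ.var 9 = (M ∩ S j).card ∧
      t ≤ 20 * (S j).card + 20 := by
  refine WP.seq (WP.assign (WP.seq (WP.assign ?_)))
  refine (WP.loop_const (S j).card
    (fun i τ => τ.var 8 = σ.arr 5 j + i ∧ Frame [8, 9] [] σ τ ∧
      τ.var 9 = ∑ l ∈ Finset.range i, σ.arr 7 (σ.arr 6 (σ.arr 5 j + l))) 12 ?_ ?_ ?_).mono ?_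
  · refine ⟨by simp [Expr.eval, hj],
      ((Frame.refl _ _ σ).setVar (by simp) _).setVar (by simp) _, by simp [Expr.eval]⟩
  · rintro i hi τ ⟨h8, hf, h9⟩
    have h7 := hf.1 7 (by simp)
    have a5 := hf.2 5 (by simp)
    have a6 := hf.2 6 (by simp)
    have a7 := hf.2 7 (by simp)
    have := hL.offset j
    refine ⟨by simp only [Expr.eval, h8, h7, a5, hj, this]; omega, ?_⟩
    refine WP.seq (WP.assign (WP.assign ⟨⟨?_, ?_, ?_⟩, ?_⟩))
    · simp [Expr.eval, h8, Nat.add_assoc]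
    · exact (hf.setVar (by simp) _).setVar (by simp) _
    · simp [Expr.eval, h8, h9, a6, a7, Finset.sum_range_succ]
    · simp [Expr.cost]
  · rintro τ ⟨h8, hf, -⟩
    have h7 := hf.1 7 (by simp)
    have a5 := hf.2 5 (by simp)
    have := hL.offset j
    simp only [Expr.eval, h8, h7, a5, hj, this]
    omega
  · rintro τ t ⟨⟨-, hf, h9⟩, ht⟩
    refine ⟨hf, h9.trans (hL.sum_eq j hM), ?_⟩
    simp only [Expr.cost] at ht ⊢
    omega

/-! ### Searching a smallest set over its quota -/

/-- Searches a smallest set over its quota. -/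
def findSet : Program :=
  .seq (.assign 10 (.lit 0)) <| .seq (.assign 7 (.lit 0)) <|
  .loop (.sub (.var 3) (.var 7)) <|
    .seq countSet <| .seq
      (.ite (.sub (.var 9) (.read 4 (.var 7)))
        (.ite (.var 10)
          (.ite (.sub (.sub (.read 5 (.var 10)) (.read 5 (.sub (.var 10) (.lit 1))))
              (.sub (.read 5 (.add (.var 7) (.lit 1))) (.read 5 (.var 7))))
            (.assign 10 (.add (.var 7) (.lit 1))) .skip)
          (.assign 10 (.add (.var 7) (.lit 1))))
        .skip)
      (.assign 7 (.add (.var 7) (.lit 1)))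

/-- Set sizes are read off as differences of consecutive offsets. Every set is recounted, at a cost
proportional to its size. -/
theorem findSet_spec (hL : Layout I S σ)
    (hM : ∀ e : Fin nE, σ.arr 7 e = if e ∈ M then 1 else 0) :
    WP findSet σ fun τ t => Frame [7, 8, 9, 10] [] σ τ ∧
      Best (fun x => ∃ j : Fin m, (j : ℕ) = x ∧ σ.arr 4 j < (M ∩ S j).card)
        (fun a b => σ.arr 5 (a + 1) - σ.arr 5 a < σ.arr 5 (b + 1) - σ.arr 5 b) m (τ.var 10) ∧
      t ≤ 70 * m + 20 * ∑ j, (S j).card + 40 := by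
  set P : ℕ → Prop := fun x => ∃ j : Fin m, (j : ℕ) = x ∧ σ.arr 4 j < (M ∩ S j).card with hP
  set lt : ℕ → ℕ → Prop :=
    fun a b => σ.arr 5 (a + 1) - σ.arr 5 a < σ.arr 5 (b + 1) - σ.arr 5 b with hlt
  refine WP.seq (WP.assign (WP.seq (WP.assign ?_)))
  refine (WP.loop m
    (fun i τ => τ.var 7 = i ∧ Frame [7, 8, 9, 10] [] σ τ ∧ Best P lt i (τ.var 10))
    (fun i => 20 * (if h : i < m then (S ⟨i, h⟩).card else 0) + 60) ?_ ?_ ?_).mono ?_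
  · refine ⟨by simp [Expr.eval], ((Frame.refl _ _ σ).setVar (by simp) _).setVar (by simp) _, ?_⟩
    simpa [Expr.eval] using Best.zero P lt
  · rintro i hi τ ⟨h7, hf, hb⟩
    have h3 := hf.1 3 (by simp)
    refine ⟨by simp only [Expr.eval, h3, hL.sets, h7]; omega, ?_⟩
    have hL' := hL.frame (hf.mono (V' := workVars) (A' := workArrs) (by decide) (by decide))
    have hM' : ∀ e : Fin nE, τ.arr 7 e = if e ∈ M then 1 else 0 := by
      rw [hf.2 7 (by simp)]
      exact hM
    refine WP.seq ((countSet_spec hL' hM' ⟨i, hi⟩ h7).mono ?_)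
    rintro υ t₁ ⟨hfυ, h9, ht₁⟩
    have hfu := hf.trans hfυ (by decide) (by simp)
    have a4 := hfu.2 4 (by simp)
    have a5 := hfu.2 5 (by simp)
    have v7 := (hfυ.1 7 (by simp)).trans h7
    have v10 := hfυ.1 10 (by simp)
    rw [← v10] at hb
    have hPi : P i ↔ υ.var 9 - υ.arr 4 (υ.var 7) ≠ 0 := by
      rw [h9, v7, a4, Nat.sub_ne_zero_iff_lt]
      constructor
      · rintro ⟨j, rfl, h⟩
        exact h
      · intro h
        exact ⟨⟨i, hi⟩, rfl, h⟩
    have hchange : P i → (υ.var 10 ≠ 0 → lt i (υ.var 10 - 1)) → Best P lt (i + 1) (i + 1) :=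
      hb.change (fun x y z => by simp only [hlt]; omega) (fun x => by simp only [hlt]; omega)
    rw [dif_pos hi]
    refine WP.seq (WP.ite (fun hc => WP.ite (fun h10 => WP.ite
      (fun hl => WP.assign ?_) fun hl => WP.skip ?_) fun h10 => WP.assign ?_) fun hc => WP.skip ?_)
    all_goals
      refine WP.assign ?_
      try simp only [Expr.eval] at hc
      try simp only [Expr.eval] at h10
      try simp only [Expr.eval, v7, a5] at hl
      simp only [Expr.eval, v7]
      refine ⟨⟨by simp [v7], ?_, ?_⟩, by simp only [Expr.cost]; omega⟩
    · exact (hfu.setVar (by simp) _).setVar (by simp) _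
    -- Variable 10 holds the set number plus one, so the offset at that index is the end of the set
    -- found.
    · have h1 : υ.var 10 - 1 + 1 = υ.var 10 := by omega
      simpa using hchange (hPi.mpr hc) fun _ => by simp only [hlt, h1]; omega
    · exact hfu.setVar (by simp) _
    · have h1 : υ.var 10 - 1 + 1 = υ.var 10 := by omega
      simp only [State.setVar_var]
      exact hb.keep fun _ => ⟨h10, by simp only [hlt, h1]; omega⟩
    · exact (hfu.setVar (by simp) _).setVar (by simp) _
    · simpa using hchange (hPi.mpr hc) fun h => absurd h10 h
    · exact hfu.setVar (by simp) _
    · simp only [State.setVar_var]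
      exact hb.keep fun h => absurd hc (hPi.mp h)
  · rintro τ ⟨h7, hf, -⟩
    have h3 := hf.1 3 (by simp)
    simp only [Expr.eval, h7, h3, hL.sets]
    omega
  · rintro τ t ⟨⟨-, hf, hb⟩, ht⟩
    refine ⟨hf, hb, ?_⟩
    have hsum : ∑ i ∈ Finset.range m, (if h : i < m then (S ⟨i, h⟩).card else 0) =
        ∑ j, (S j).card := by
      rw [← Fin.sum_univ_eq_sum_range (fun i => if h : i < m then (S ⟨i, h⟩).card else 0)]
      simp
    simp only [Finset.sum_add_distrib, ← Finset.mul_sum, hsum, Finset.sum_const,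
      Finset.card_range, smul_eq_mul, Expr.cost] at ht ⊢
    omega

/-! ### Searching the contract to be rejected -/

/-- Searches the last contract of the tentative matching in the set found. -/
def findWorst : Program :=
  .seq (.assign 11 (.sub (.var 6) (.lit 1))) <|
  .seq (.assign 8 (.read 5 (.sub (.var 10) (.lit 1)))) <|
  .loop (.sub (.read 5 (.var 10)) (.var 8)) <|
    .seq
      (.ite (.read 7 (.read 6 (.var 8)))
        (.ite (.sub (.read 3 (.read 6 (.var 8))) (.read 3 (.var 11)))
          (.assign 11 (.read 6 (.var 8)))
          (.ite (.sub (.read 3 (.var 11)) (.read 3 (.read 6 (.var 8)))) .skip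
            (.ite (.sub (.read 6 (.var 8)) (.var 11)) (.assign 11 (.read 6 (.var 8))) .skip)))
        .skip)
      (.assign 8 (.add (.var 8) (.lit 1)))

/-- Starting from the proposed contract, which lies in the set, avoids an empty case. Two truncated
subtractions separate the three outcomes of comparing positions; among equal positions the larger
index is the worse. -/
theorem findWorst_spec (hL : Layout I S σ)
    (hM : ∀ e : Fin nE, σ.arr 7 e = if e ∈ M then 1 else 0) (j : Fin m) (hj : σ.var 10 = j + 1)
    (e : Fin nE) (he : σ.var 6 = e + 1) (heM : e ∈ M ∩ S j) :
    WP findWorst σ fun τ t => Frame [8, 11] [] σ τ ∧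
      (∃ e' ∈ M ∩ S j, τ.var 11 = e' ∧
        ∀ x ∈ M ∩ S j, x ≠ e' → KeyLt (σ.arr 3) x e') ∧ t ≤ 70 * (S j).card + 40 := by
  refine WP.seq (WP.assign (WP.seq (WP.assign ?_)))
  refine (WP.loop_const (S j).card
    (fun i τ => τ.var 8 = σ.arr 5 j + i ∧ Frame [8, 11] [] σ τ ∧
      ∃ e' ∈ M ∩ S j, τ.var 11 = e' ∧ ∀ l < i, ∀ x ∈ M, σ.arr 6 (σ.arr 5 j + l) = (x : ℕ) →
        x ≠ e' → KeyLt (σ.arr 3) x e') 50 ?_ ?_ ?_).mono ?_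
  · refine ⟨by simp [Expr.eval, hj],
      ((Frame.refl _ _ σ).setVar (by simp) _).setVar (by simp) _, e, heM, ?_, by simp⟩
    simp [Expr.eval, he]
  · rintro i hi τ ⟨h8, hf, e', he', h11, hmax⟩
    have h10 := hf.1 10 (by simp)
    have a3 := hf.2 3 (by simp)
    have a5 := hf.2 5 (by simp)
    have a6 := hf.2 6 (by simp)
    have a7 := hf.2 7 (by simp)
    have := hL.offset j
    refine ⟨by simp only [Expr.eval, h8, h10, a5, hj, this]; omega, ?_⟩
    obtain ⟨y, hy, hyi⟩ := hL.exists_elem j hi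
    have hyM := hM y
    have hchange : y ∈ M → KeyLt (σ.arr 3) e' y → ∀ l < i + 1, ∀ x ∈ M,
        σ.arr 6 (σ.arr 5 j + l) = (x : ℕ) → x ≠ y → KeyLt (σ.arr 3) x y := by
      intro hyM hlt l hl x hx hxl hxy
      rcases Nat.lt_succ_iff_lt_or_eq.mp hl with hl | rfl
      · by_cases hxe : x = e'
        · exact hxe ▸ hlt
        · have := hmax l hl x hx hxl hxe
          unfold KeyLt at *
          omega
      · exact absurd (Fin.ext (hxl.symm.trans hyi)) hxy
    have hkeep : (y ∈ M → y ≠ e' → KeyLt (σ.arr 3) y e') → ∀ l < i + 1, ∀ x ∈ M,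
        σ.arr 6 (σ.arr 5 j + l) = (x : ℕ) → x ≠ e' → KeyLt (σ.arr 3) x e' := by
      intro hk l hl x hx hxl hxe
      rcases Nat.lt_succ_iff_lt_or_eq.mp hl with hl | rfl
      · exact hmax l hl x hx hxl hxe
      · have hxy : x = y := Fin.ext (hxl.symm.trans hyi)
        subst hxy
        exact hk hx hxe
    have hmem : (if y ∈ M then 1 else 0) ≠ 0 → y ∈ M := fun h => by
      by_contra h'
      simp [h'] at h
    refine WP.seq (WP.ite (fun hc => WP.ite (fun h1 => WP.assign ?_) fun h1 => WP.ite
      (fun h2 => WP.skip ?_) fun h2 => WP.ite (fun h3 => WP.assign ?_) fun h3 => WP.skip ?_)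
      fun hc => WP.skip ?_)
    all_goals
      refine WP.assign ?_
      try simp only [Expr.eval, h8, a6, a7, hyi, hyM] at hc
      try simp only [Expr.eval, h8, a3, a6, h11, hyi] at h1
      try simp only [Expr.eval, h8, a3, a6, h11, hyi] at h2
      try simp only [Expr.eval, h8, a6, h11, hyi] at h3
      simp only [Expr.eval, h8, a6, hyi]
      refine ⟨⟨by simp [h8, Nat.add_assoc], ?_, ?_⟩, by simp [Expr.cost]⟩
    · exact (hf.setVar (by simp) _).setVar (by simp) _
    · exact ⟨y, Finset.mem_inter.mpr ⟨hmem hc, hy⟩, by simp,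
        hchange (hmem hc) (Or.inl (by omega))⟩
    · exact hf.setVar (by simp) _
    · exact ⟨e', he', by simp [h11], hkeep fun _ _ => Or.inl (by omega)⟩
    · exact (hf.setVar (by simp) _).setVar (by simp) _
    · exact ⟨y, Finset.mem_inter.mpr ⟨hmem hc, hy⟩, by simp,
        hchange (hmem hc) (Or.inr (by omega))⟩
    · exact hf.setVar (by simp) _
    · refine ⟨e', he', by simp [h11], hkeep fun _ hne => Or.inr ?_⟩
      have : (y : ℕ) ≠ e' := fun h => hne (Fin.ext h)
      omega
    · exact hf.setVar (by simp) _
    · exact ⟨e', he', by simp [h11], hkeep fun h => absurd hc (by simp [h])⟩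
  · rintro τ ⟨h8, hf, -⟩
    have h10 := hf.1 10 (by simp)
    have a5 := hf.2 5 (by simp)
    have := hL.offset j
    simp only [Expr.eval, h8, h10, a5, hj, this]
    omega
  · rintro τ t ⟨⟨-, hf, e', he', h11, hmax⟩, ht⟩
    refine ⟨hf, ⟨e', he', h11, fun x hx hxe => ?_⟩, ?_⟩
    · rw [Finset.mem_inter] at hx
      obtain ⟨l, hl, hlx⟩ := (hL.mem_iff j x).mp hx.2
      exact hmax l hl x hx.1 hlx hxe
    · simp only [Expr.cost] at ht ⊢
      omega

end OLC

/-! ### Correctness and running time of the whole program -/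

namespace OLC

variable {nW nF nE m : ℕ} {I : Market nW nF nE} {S : Fin m → Finset (Fin nE)} {σ τ : State}
  {M R : Finset (Fin nE)}

/-! ### The total size of the laminar sets -/

open Classical in
-- Double counting: the sets containing a fixed contract all belong to its firm and meet pairwise,
-- so by laminarity they form a chain of length at most `I.level`.
theorem Layout.sum_card_le (hL : Layout I S σ) : ∑ j, (S j).card ≤ nE * I.level := by
  have h1 : ∑ j, (S j).card = ∑ e : Fin nE, (Finset.univ.filter fun j => e ∈ S j).card := by
    simp only [Finset.card_eq_sum_ones, Finset.sum_filter]
    rw [Finset.sum_comm]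
    refine Finset.sum_congr rfl fun j _ => ?_
    rw [← Finset.sum_filter, Finset.filter_mem_eq_inter, Finset.univ_inter]
  rw [h1]
  refine (Finset.sum_le_card_nsmul _ _ I.level fun e _ => ?_).trans (by simp)
  have hlam : ∀ j, e ∈ S j → S j ∈ I.lam (I.firm e) := by
    intro j hj
    obtain ⟨-, f, hf⟩ := (hL.exists_iff (S j)).mp ⟨j, rfl⟩
    rwa [I.lam_sub f _ hf e hj]
  set C := (Finset.univ.filter fun j => e ∈ S j).image S with hC
  have hcard : (Finset.univ.filter fun j => e ∈ S j).card = C.card :=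
    (Finset.card_image_of_injective _ hL.injective).symm
  rw [hcard]
  have hmem : C ∈ (I.lam (I.firm e)).powerset.filter fun C : Finset (Finset (Fin nE)) =>
      IsChain (· ⊆ ·) (C : Set (Finset (Fin nE))) := by
    have hC' : ∀ L ∈ C, e ∈ L ∧ L ∈ I.lam (I.firm e) := by
      intro L hL'
      obtain ⟨j, hj, rfl⟩ := Finset.mem_image.mp hL'
      have := (Finset.mem_filter.mp hj).2
      exact ⟨this, hlam j this⟩
    rw [Finset.mem_filter, Finset.mem_powerset]
    refine ⟨fun L h => (hC' L h).2, ?_⟩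
    intro L h L' h' _
    rcases I.laminar _ L (hC' L h).2 L' (hC' L' h').2 with hs | hs | hs
    · exact Or.inl hs
    · exact Or.inr hs
    · exact absurd (hC' L' h').1 (Finset.disjoint_left.mp hs (hC' L h).1)
  exact (Finset.le_sup (f := Finset.card) hmem).trans
    (Finset.le_sup (f := fun f => ((I.lam f).powerset.filter fun C : Finset (Finset (Fin nE)) =>
      IsChain (· ⊆ ·) (C : Set (Finset (Fin nE)))).sup Finset.card) (Finset.mem_univ (I.firm e)))

/-- The listed sets are nonempty, so the number of sets needs no bound of its own in the running
time. -/
theorem Layout.le_sum_card (hL : Layout I S σ) : m ≤ ∑ j, (S j).card := by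
  have : ∑ _j : Fin m, 1 ≤ ∑ j, (S j).card := Finset.sum_le_sum fun j _ =>
    Finset.card_pos.mpr ((hL.exists_iff (S j)).mp ⟨j, rfl⟩).1
  simpa using this

/-! ### Positions and preferences -/

theorem Layout.keyLt_worker (hL : Layout I S σ) {e x : Fin nE}
    (h : (I.breakTies.wPref (I.worker e)).Prefers x e) :
    I.worker x = I.worker e ∧ KeyLt (σ.arr 2) x e := by
  obtain ⟨hx, he, hlt⟩ := PrefList.prefers_breakTies_iff.mp h
  have hw := I.wPref_sub _ x hx
  refine ⟨hw, ?_⟩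
  have h1 := hL.worker_acc x (Market.acceptable_of_mem hx)
  rw [hw] at h1
  have h2 := hL.worker_acc e he
  unfold KeyLt
  rw [h1, h2]
  rcases hlt with hlt | ⟨heq, hlt⟩
  · exact Or.inl (by omega)
  · exact Or.inr ⟨by omega, hlt⟩

theorem Layout.prefers_firm (hL : Layout I S σ) {e x : Fin nE} {f : Fin nF} (he : I.firm e = f)
    (hx : I.firm x = f) (h : KeyLt (σ.arr 3) x e) : (I.breakTies.fPref f).Prefers x e := by
  subst he
  have h1 := hL.firm_pos x
  have h2 := hL.firm_pos e
  rw [hx] at h1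
  unfold KeyLt at h
  rw [h1, h2] at h
  refine PrefList.prefers_breakTies_iff.mpr
    ⟨(I.fPref_iff _ x).mpr hx, (I.fPref_iff _ e).mpr rfl, ?_⟩
  rcases h with h | ⟨h, h'⟩
  · exact Or.inl (by omega)
  · exact Or.inr ⟨by omega, h'⟩

/-! ### Initialization -/

/-- Starts with the empty matching; the unacceptable contracts are rejected. -/
def setUp : Program :=
  .seq (.assign 5 (.lit 0)) <|
  .loop (.sub (.var 0) (.var 5)) <|
    .seq (.write 7 (.var 5) (.lit 0)) <|
    .seq (.write 8 (.var 5) (.sub (.lit 1) (.read 2 (.var 5)))) <|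
    .seq (.write 9 (.read 0 (.var 5)) (.lit 0)) <|
    .assign 5 (.add (.var 5) (.lit 1))

open Classical in
-- Worker flags are cleared by running through the contracts, so the time does not depend on `nW`;
-- flags of workers without contracts are never read.
theorem setUp_spec (hL : Layout I S σ) :
    WP setUp σ fun τ t => Frame workVars workArrs σ τ ∧
      Holds I ∅ (Finset.univ.filter fun e => ¬ I.breakTies.Acceptable e) τ ∧
      t ≤ 30 * nE + 30 := by
  refine WP.seq (WP.assign ?_)
  refine (WP.loop_const nE
    (fun i τ => τ.var 5 = i ∧ Frame workVars workArrs σ τ ∧ ∀ e : Fin nE, (e : ℕ) < i →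
      τ.arr 7 e = 0 ∧ τ.arr 8 e = (if I.Acceptable e then 0 else 1) ∧ τ.arr 9 (I.worker e) = 0)
    20 ?_ ?_ ?_).mono ?_
  · exact ⟨by simp [Expr.eval], (Frame.refl _ _ σ).setVar (by decide) _,
      fun e he => absurd he (Nat.not_lt_zero _)⟩
  · rintro i hi τ ⟨h5, hf, h⟩
    have hL' := hL.frame hf
    refine ⟨by simp only [Expr.eval, hL'.contracts, h5]; omega, ?_⟩
    refine WP.seq (WP.write (WP.seq (WP.write (WP.seq (WP.write (WP.assign ⟨⟨?_, ?_, ?_⟩, ?_⟩))))))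
    · simp [Expr.eval, h5]
    · exact (((hf.setArr (by decide) _ _).setArr (by decide) _ _).setArr (by decide) _ _).setVar
        (by decide) _
    · intro e he
      have hw := hL'.worker e
      -- Truncated subtraction turns position 0, meaning unacceptable, into 1 and every positive
      -- position into 0.
      have hacc : 1 - τ.arr 2 e = if I.Acceptable e then 0 else 1 := by
        split_ifs with ha
        · rw [hL'.worker_acc e ha]
          omega
        · rw [hL'.worker_unacc e ha]
      rcases Nat.lt_succ_iff_lt_or_eq.mp he with he | he
      · obtain ⟨h7, h8, h9⟩ := h e he
        simp [Expr.eval, h5, h7, h8, h9, he.ne]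
      · subst he
        simp [Expr.eval, h5, hw, hacc]
    · simp [Expr.cost]
  · rintro τ ⟨h5, hf, -⟩
    simp only [Expr.eval, h5, (hL.frame hf).contracts]
    omega
  · rintro τ t ⟨⟨-, hf, h⟩, ht⟩
    refine ⟨hf, ⟨fun e => ?_, fun e => ?_, fun e => ?_⟩, ?_⟩
    · simpa using (h e e.2).1
    · have hacc : I.breakTies.Acceptable e ↔ I.Acceptable e :=
        (I.wPref (I.worker e)).mem_breakTies e
      rw [(h e e.2).2.1]
      simp [hacc, ite_not]
    · simpa using (h e e.2).2.2
    · simp only [Expr.cost] at ht ⊢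
      omega

/-! ### One round of deferred acceptance -/

theorem Holds.add (h : Holds I M R σ) (e : Fin nE) :
    Holds I (insert e M) R ((σ.setArr 7 e 1).setArr 9 (I.worker e) 1) where
  matched x := by
    have := h.matched x
    by_cases hx : x = e
    · subst hx
      simp
    · have hx' : (x : ℕ) ≠ e := fun h => hx (Fin.ext h)
      simp [hx, hx', this]
  rejected x := by simpa using h.rejected x
  busy x := by
    have := h.busy x
    by_cases hx : I.worker x = I.worker e
    · simp [hx]
    · have hx' : (I.worker x : ℕ) ≠ I.worker e := fun h => hx (Fin.ext h)
      have hx'' : ¬ I.worker e = I.worker x := fun h => hx h.symm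
      simp [hx', hx'', this]

/-- Clearing the worker's flag is correct because `e` is her only contract in `M`. -/
theorem Holds.reject (h : Holds I M R σ) {e : Fin nE}
    (huniq : ∀ x ∈ M, I.worker x = I.worker e → x = e) :
    Holds I (M.erase e) (insert e R)
      (((σ.setArr 7 e 0).setArr 8 e 1).setArr 9 (I.worker e) 0) where
  matched x := by
    have := h.matched x
    by_cases hx : x = e
    · subst hx
      simp
    · have hx' : (x : ℕ) ≠ e := fun h => hx (Fin.ext h)
      simp [hx, hx', this]
  rejected x := by
    have := h.rejected x
    by_cases hx : x = e
    · subst hx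
      simp
    · have hx' : (x : ℕ) ≠ e := fun h => hx (Fin.ext h)
      simp [hx, hx', this]
  busy x := by
    have := h.busy x
    by_cases hx : I.worker x = I.worker e
    · have hno : ¬ ∃ y ∈ M.erase e, I.worker y = I.worker x := by
        rintro ⟨y, hy, hyx⟩
        rw [Finset.mem_erase] at hy
        exact hy.1 (huniq y hy.2 (hyx.trans hx))
      rw [if_neg hno]
      simp [hx]
    · have hx' : (I.worker x : ℕ) ≠ I.worker e := fun h => hx (Fin.ext h)
      have hiff : (∃ y ∈ M.erase e, I.worker y = I.worker x) ↔ ∃ y ∈ M, I.worker y = I.worker x := by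
        constructor
        · rintro ⟨y, hy, hyx⟩
          exact ⟨y, Finset.mem_of_mem_erase hy, hyx⟩
        · rintro ⟨y, hy, hyx⟩
          exact ⟨y, Finset.mem_erase.mpr ⟨fun hye => hx (hye ▸ hyx.symm), hy⟩, hyx⟩
      simp only [hiff]
      simp [hx', this]

/-- One proposal, if there is a candidate. -/
def round : Program :=
  .seq findCandidate <| .ite (.var 6)
    (.seq (.write 7 (.sub (.var 6) (.lit 1)) (.lit 1)) <|
      .seq (.write 9 (.read 0 (.sub (.var 6) (.lit 1))) (.lit 1)) <|
      .seq findSet <| .ite (.var 10)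
        (.seq findWorst <| .seq (.write 7 (.var 11) (.lit 0)) <|
          .seq (.write 8 (.var 11) (.lit 1)) <| .write 9 (.read 0 (.var 11)) (.lit 0))
        .skip)
    .skip

/-- Unlisted members are empty and can never exceed their quotas. -/
theorem Layout.feasible (hL : Layout I S σ)
    (h : ∀ j : Fin m, ¬ σ.arr 4 j < (M ∩ S j).card) : I.breakTies.Feasible M := by
  intro f L
  by_contra hc
  push Not at hc
  have hne : L.1.Nonempty := by
    obtain ⟨x, hx⟩ := Finset.card_pos.mp (Nat.zero_lt_of_lt hc)
    exact ⟨x, (Finset.mem_inter.mp hx).2⟩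
  obtain ⟨j, hj⟩ := (hL.exists_iff L.1).mpr ⟨hne, f, L.2⟩
  obtain ⟨L, hLf⟩ := L
  subst hj
  exact h j (by rw [hL.quota j f hLf]; exact hc)

theorem Layout.overfull (hL : Layout I S σ) {e e' : Fin nE} {j : Fin m}
    (hj : σ.arr 4 j < (insert e M ∩ S j).card)
    (hmin : ∀ i : Fin m, σ.arr 4 i < (insert e M ∩ S i).card → (S j).card ≤ (S i).card)
    (he' : e' ∈ insert e M ∩ S j)
    (hworst : ∀ x ∈ insert e M ∩ S j, x ≠ e' → KeyLt (σ.arr 3) x e') :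
    ∃ f, ∃ L, I.breakTies.Overfull M e e' f L := by
  obtain ⟨-, f, hf⟩ := (hL.exists_iff (S j)).mp ⟨j, rfl⟩
  refine ⟨f, ⟨S j, hf⟩, ?_, ?_, he', ?_⟩
  · have := hL.quota j f hf
    rw [this] at hj
    exact hj
  · rintro ⟨L', hL'⟩ hlt
    have hne : L'.Nonempty := by
      obtain ⟨x, hx⟩ := Finset.card_pos.mp (Nat.zero_lt_of_lt hlt)
      exact ⟨x, (Finset.mem_inter.mp hx).2⟩
    obtain ⟨i, rfl⟩ := (hL.exists_iff L').mpr ⟨hne, f, hL'⟩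
    exact hmin i (by rw [hL.quota i f hL']; exact hlt)
  · intro x hx hxe
    exact hL.prefers_firm (I.lam_sub f _ hf e' (Finset.mem_inter.mp he').2)
      (I.lam_sub f _ hf x (Finset.mem_inter.mp hx).2) (hworst x hx hxe)

/-- Demanding a candidate before the round in the progress case makes termination permanent: once
there is no candidate, later rounds cannot create one. -/
theorem round_spec (hL : Layout I S σ) (hH : Holds I M R σ) (hinv : I.breakTies.DAInv M R) :
    WP round σ fun τ t => Frame [5, 6, 7, 8, 9, 10, 11] [7, 8, 9] σ τ ∧
      (∃ M' R', I.breakTies.DAInv M' R' ∧ Holds I M' R' τ ∧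
        ((∀ e, ¬ I.Candidate M' R' e) ∨
          (∃ e, I.Candidate M R e) ∧ (M' ∪ R').card = (M ∪ R).card + 1)) ∧
      t ≤ 40 * nE + 70 * m + 90 * ∑ j, (S j).card + 150 := by
  refine WP.seq ((findCandidate_spec hL hH).mono ?_)
  rintro σ₁ t₁ ⟨hf₁, hb₁, ht₁⟩
  have hH₁ := hH.frame hf₁
  have hf₁' : Frame [5, 6, 7, 8, 9, 10, 11] [7, 8, 9] σ σ₁ := hf₁.mono (by decide) (by decide)
  rcases hb₁ with ⟨h6, hnone⟩ | ⟨_, -, h6, ⟨e, rfl, hc⟩, hmin⟩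
  · refine WP.ite (fun h => absurd h6 h) fun _ => WP.skip ?_
    refine ⟨hf₁', ⟨M, R, hinv, hH₁, Or.inl fun e he => hnone e e.2 ⟨e, rfl, he⟩⟩, ?_⟩
    simp only [Expr.cost]
    omega
  have hcJ : I.breakTies.Candidate M R e := ⟨hc.notMem, hc.free⟩
  have hbest : ∀ x, (I.breakTies.wPref (I.breakTies.worker e)).Prefers x e → x ∈ R := by
    intro x hx
    obtain ⟨hw, hlt⟩ := hL.keyLt_worker hx
    by_contra hxR
    exact hmin x x.2 ⟨x, rfl, hxR, fun y hy => hw ▸ hc.free y hy⟩ hlt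
  have hcard : ∀ M' R', M' ∪ R' = insert e (M ∪ R) → (M' ∪ R').card = (M ∪ R).card + 1 := by
    intro M' R' h
    rw [h, Finset.card_insert_of_notMem]
    rw [Finset.mem_union, not_or]
    exact ⟨hcJ.notMem_left, hc.notMem⟩
  refine WP.ite (fun _ => ?_) fun h => absurd h (by simp [Expr.eval, h6])
  refine WP.seq (WP.write (WP.seq (WP.write ?_)))
  have hL₁ := hL.frame (hf₁'.mono (V' := workVars) (A' := workArrs) (by decide) (by decide))
  set σ₂ := (σ₁.setArr 7 e 1).setArr 9 (I.worker e) 1 with hσ₂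
  have hev : (σ₁.setArr 7 ((Expr.sub (.var 6) (.lit 1)).eval σ₁) ((Expr.lit 1).eval σ₁)).setArr 9
      ((Expr.read 0 (.sub (.var 6) (.lit 1))).eval
        (σ₁.setArr 7 ((Expr.sub (.var 6) (.lit 1)).eval σ₁) ((Expr.lit 1).eval σ₁)))
      ((Expr.lit 1).eval
        (σ₁.setArr 7 ((Expr.sub (.var 6) (.lit 1)).eval σ₁) ((Expr.lit 1).eval σ₁))) = σ₂ := by
    simp [Expr.eval, h6, hσ₂, hL₁.worker e]
  rw [hev]
  have hH₂ : Holds I (insert e M) R σ₂ := hH₁.add e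
  have hf₂ : Frame [5, 6, 7, 8, 9, 10, 11] [7, 8, 9] σ σ₂ :=
    (hf₁'.setArr (by decide) _ _).setArr (by decide) _ _
  have hL₂ := hL.frame (hf₂.mono (V' := workVars) (A' := workArrs) (by decide) (by decide))
  refine WP.seq ((findSet_spec hL₂ hH₂.matched).mono ?_)
  rintro σ₃ t₃ ⟨hf₃, hb₃, ht₃⟩
  have hH₃ := hH₂.frame hf₃
  have hf₃' : Frame [5, 6, 7, 8, 9, 10, 11] [7, 8, 9] σ σ₃ := hf₂.trans hf₃ (by decide) (by simp)
  have hL₃ := hL.frame (hf₃'.mono (V' := workVars) (A' := workArrs) (by decide) (by decide))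
  rcases hb₃ with ⟨h10, hnone⟩ | ⟨_, -, h10, ⟨j, rfl, hj⟩, hsmall⟩
  · refine WP.ite (fun h => absurd h10 h) fun _ => WP.skip ?_
    refine ⟨hf₃', ⟨insert e M, R, hinv.accept hcJ hbest ?_, hH₃,
      Or.inr ⟨⟨e, hc⟩, hcard _ _ (Finset.insert_union _ _ _)⟩⟩, ?_⟩
    · exact hL₂.feasible fun j hj => hnone j j.2 ⟨j, rfl, hj⟩
    · simp only [Expr.cost]
      omega
  refine WP.ite (fun _ => ?_) fun h => absurd h (by simp [Expr.eval, h10])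
  have hmin' : ∀ i : Fin m, σ₂.arr 4 i < (insert e M ∩ S i).card → (S j).card ≤ (S i).card := by
    intro i hi
    have := hsmall i i.2 ⟨i, rfl, hi⟩
    have h1 := hL₂.offset i
    have h2 := hL₂.offset j
    omega
  have hover : ∃ f, ∃ L : {L // L ∈ I.breakTies.lam f}, L.1 = S j ∧
      I.breakTies.quota f L < (insert e M ∩ L.1).card := by
    obtain ⟨-, f, hf⟩ := (hL.exists_iff (S j)).mp ⟨j, rfl⟩
    refine ⟨f, ⟨S j, hf⟩, rfl, ?_⟩
    have := hL₂.quota j f hf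
    rw [this] at hj
    exact hj
  -- An overfull set contains the new contract; this justifies the starting value of `findWorst`.
  have heS : e ∈ S j := by
    obtain ⟨f, L, hLS, hlt⟩ := hover
    rw [← hLS]
    exact (Market.over_mem hinv.matching.feasible hlt).1
  have h6₃ : σ₃.var 6 = e + 1 := by
    rw [hf₃.1 6 (by decide)]
    exact h6
  refine WP.seq ((findWorst_spec hL₃ hH₃.matched j h10 e h6₃
    (Finset.mem_inter.mpr ⟨Finset.mem_insert_self _ _, heS⟩)).mono ?_)
  rintro σ₄ t₄ ⟨hf₄, ⟨e', he', h11, hworst⟩, ht₄⟩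
  have hH₄ := hH₃.frame hf₄
  have hf₄' : Frame [5, 6, 7, 8, 9, 10, 11] [7, 8, 9] σ σ₄ := hf₃'.trans hf₄ (by decide) (by simp)
  have hL₄ := hL.frame (hf₄'.mono (V' := workVars) (A' := workArrs) (by decide) (by decide))
  have a3 : σ₃.arr 3 = σ₂.arr 3 := hf₃.2 3 (by simp)
  rw [a3] at hworst
  obtain ⟨f, L, hfull⟩ := hL₂.overfull hj hmin' he' hworst
  have huniq : ∀ x ∈ insert e M, I.worker x = I.worker e' → x = e' := by
    intro x hx hw
    exact Finset.card_le_one.mp (hcJ.worker_le hinv.matching (I.worker e')) x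
      (Market.mem_ofWorker.mpr ⟨hx, hw⟩) e'
      (Market.mem_ofWorker.mpr ⟨(Finset.mem_inter.mp he').1, rfl⟩)
  have hH₅ := hH₄.reject huniq
  refine WP.seq (WP.write (WP.seq (WP.write (WP.write ⟨?_, ?_, ?_⟩))))
  · exact ((hf₄'.setArr (by decide) _ _).setArr (by decide) _ _).setArr (by decide) _ _
  · refine ⟨_, _, hinv.reject (I.strict_breakTies) hcJ hbest hfull, ?_, 
      Or.inr ⟨⟨e, hc⟩, hcard _ _ ?_⟩⟩
    · simpa [Expr.eval, h11, hL₄.worker e'] using hH₅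
    · rw [Finset.union_insert, ← Finset.insert_union,
        Finset.insert_erase (Finset.mem_inter.mp he').1, Finset.insert_union]
  · have hle : (S j).card ≤ ∑ j, (S j).card :=
      Finset.single_le_sum (f := fun j => (S j).card) (fun _ _ => Nat.zero_le _) (Finset.mem_univ j)
    simp only [Expr.cost]
    omega

/-! ### The algorithm -/

/-- Deferred acceptance. -/
def deferredAcceptance : Program :=
  .seq setUp <| .seq (.assign 4 (.lit 0)) <|
  .loop (.sub (.var 0) (.var 4)) <| .seq round (.assign 4 (.add (.var 4) (.lit 1)))

/-- Exactly `nE` rounds are run, idle ones included. If all made progress, `M ∪ R` contains every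
contract and no candidate is left. -/
theorem deferredAcceptance_spec (hL : Layout I S σ) :
    WP deferredAcceptance σ fun τ t =>
      (∃ M, I.breakTies.IsWorkerOptimal M ∧ IsOutput M τ) ∧
      t ≤ 1000 * max I.level 1 * (max nE 1) ^ 2 := by
  refine WP.seq ((setUp_spec hL).mono ?_)
  rintro σ₁ t₁ ⟨hf₁, hH₁, ht₁⟩
  refine WP.seq (WP.assign ?_)
  refine (WP.loop_const nE (fun i τ => τ.var 4 = i ∧ Frame workVars workArrs σ τ ∧
    ∃ M R, I.breakTies.DAInv M R ∧ Holds I M R τ ∧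
      ((∀ e, ¬ I.Candidate M R e) ∨ i ≤ (M ∪ R).card))
    (40 * nE + 70 * m + 90 * ∑ j, (S j).card + 160) ?_ ?_ ?_).mono ?_
  · refine ⟨by simp [Expr.eval], hf₁.setVar (by decide) _, _, _, I.breakTies.daInv_empty, ?_,
      Or.inr (Nat.zero_le _)⟩
    exact hH₁.frame (V := [4]) ((Frame.refl _ _ σ₁).setVar (by simp) _)
  · rintro i hi τ ⟨h4, hf, M, R, hinv, hH, hdone⟩
    have hLτ := hL.frame hf
    refine ⟨by simp only [Expr.eval, hLτ.contracts, h4]; omega, ?_⟩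
    refine WP.seq ((round_spec hLτ hH hinv).mono ?_)
    rintro υ t ⟨hfυ, ⟨M', R', hinv', hH', hdone'⟩, ht⟩
    refine WP.assign ⟨⟨?_, ?_, M', R', hinv', ?_, ?_⟩, ?_⟩
    · simp [Expr.eval, hfυ.1 4 (by simp), h4]
    · exact (hf.trans hfυ (by decide) (by decide)).setVar (by decide) _
    · exact hH'.frame (V := [4]) ((Frame.refl _ _ υ).setVar (by simp) _)
    · rcases hdone' with h | ⟨⟨e, he⟩, h⟩
      · exact Or.inl h
      · rcases hdone with h' | h'
        · exact absurd he (h' e)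
        · exact Or.inr (by omega)
    · simp only [Expr.cost]
      omega
  · rintro τ ⟨h4, hf, -⟩
    simp only [Expr.eval, h4, (hL.frame hf).contracts]
    omega
  · rintro τ t ⟨⟨-, -, M, R, hinv, hH, hdone⟩, ht⟩
    have hnone : ∀ e, ¬ I.breakTies.Candidate M R e := by
      rcases hdone with h | h
      · exact fun e he => h e ⟨he.notMem, he.free⟩
      · intro e he
        have huniv : M ∪ R = Finset.univ :=
          (Finset.card_eq_iff_eq_univ _).mp (le_antisymm (Finset.card_le_univ _) (by simpa using h))
        have hmem := Finset.mem_univ e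
        rw [← huniv, Finset.mem_union] at hmem
        exact hmem.elim he.notMem_left he.notMem
    refine ⟨⟨M, hinv.isWorkerOptimal hnone, hH.matched⟩, ?_⟩
    have h1 := hL.sum_card_le
    have h2 := hL.le_sum_card
    simp only [Expr.cost, Nat.reduceAdd] at ht ⊢
    set Z := ∑ j, (S j).card
    set k := max I.level 1 with hk
    set N := max nE 1 with hN
    have hk1 : 1 ≤ k := le_max_right _ _
    have hN1 : 1 ≤ N := le_max_right _ _
    have hnN : nE ≤ N := le_max_left _ _
    have hZ : Z ≤ N * k := h1.trans (Nat.mul_le_mul hnN (le_max_left _ _))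
    have hNk : N ≤ N * k := Nat.le_mul_of_pos_right _ hk1
    -- Each of `nE`, `m`, `Z` and 1 is at most `N * k`, and the coefficients sum to 364; the 4 is
    -- the loop test.
    have hbody : 40 * nE + 70 * m + 90 * Z + 160 + 4 ≤ 400 * (N * k) := by omega
    have h3 : nE * (40 * nE + 70 * m + 90 * Z + 160 + 4) ≤ N * (400 * (N * k)) :=
      Nat.mul_le_mul hnN hbody
    have h4 : N * k ≤ N * (N * k) := Nat.le_mul_of_pos_left _ hN1
    have h5 : 1000 * k * N ^ 2 = 1000 * (N * (N * k)) := by ring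
    have h6 : N * (400 * (N * k)) = 400 * (N * (N * k)) := by ring
    rw [h5]
    omega

end OLC

theorem theorem6 :
    ∃ A : OLC.Mechanism,
      (∀ (nW nF nE : ℕ) (I : OLC.Market nW nF nE),
        I.breakTies.IsWorkerOptimal (A nW nF nE I)) ∧
      A.WorkerStrategyProof ∧
      (∀ (nW nF nE : ℕ) (I : OLC.Market nW nF nE),
        I.IsStable (A nW nF nE I) ∧
        ∀ Mopt : Finset (Fin nE), I.IsMaxStable Mopt →
          (1 / 2 : ℝ) * (Mopt.card : ℝ) ≤ ((A nW nF nE I).card : ℝ)) ∧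
      ∃ (p : OLC.Program) (C : ℕ),
        ∀ (nW nF nE : ℕ) (I : OLC.Market nW nF nE) (σ : OLC.State), OLC.IsInput I σ →
          ∃ (σ' : OLC.State) (t : ℕ), OLC.Run p σ σ' t ∧
            OLC.IsOutput (A nW nF nE I) σ' ∧
            t ≤ C * max I.level 1 * (max nE 1) ^ 2 := by
  choose A hA using fun nW nF nE (I : OLC.Market nW nF nE) =>
    I.strict_breakTies.exists_isWorkerOptimal
  refine ⟨A, hA, ?_, ?_, OLC.deferredAcceptance, 1000, ?_⟩
  · intro nW nF nE I w P hP
    have h := (hA nW nF nE (I.replaceList w P hP)).1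
    rw [OLC.Market.replaceList_breakTies] at h
    exact ((hA nW nF nE I).weaklyPrefers_replaceList I.strict_breakTies h).of_breakTies
  · intro nW nF nE I
    have hs := (hA nW nF nE I).1.of_breakTies
    refine ⟨hs, fun Mopt hM => ?_⟩
    have : (Mopt.card : ℝ) ≤ 2 * ((A nW nF nE I).card : ℝ) := by
      exact_mod_cast OLC.Market.card_le_two_mul hs hM.1.1
    linarith
  · intro nW nF nE I σ hσ
    obtain ⟨m, S, hL⟩ := hσ.exists_layout
    obtain ⟨σ', t, hr, ⟨M, hM, hout⟩, ht⟩ := OLC.deferredAcceptance_spec hL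
    -- `A` was obtained by choice; uniqueness identifies its value with the computed matching.
    rw [hM.unique I.strict_breakTies (hA nW nF nE I)] at hout
    exact ⟨σ', t, hr, hout, ht⟩
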